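/- Let $K$ be a field. All hypergraphs and presentations below are finite. **Hypergraphs.** A hypergraph $H=(H^0,H^1,s,r)$ consists of finite sets $H^0$ (vertices) and $H^1$ (hyperedges) and of maps $s,r$ assigning to each $h\in H^1$ nonempty multisets $s(h),r(h):H^0\to\mathbb N_0$. For $h\in H^1$ put $I_h=\{(u,k)\mid 1\le k\le s(h)(u)\}$ and $J_h=\{(v,l)\mid 1\le l\le r(h)(v)\}$. The Leavitt path algebra $L(H)$ is the $K$-algebra with generators $v$, $h_{ij}$, $h_{ij}^*$ ($v\in H^0$, $h\in H^1$, $i\in I_h$, $j\in J_h$) and relations: $uv=\delta_{uv}u$ for $u,v\in H^0$, with $\sum_{v\in H^0}v=1$; $uh_{ij}=h_{ij}=h_{ij}v$ and $vh_{ij}^*=h_{ij}^*=h_{ij}^*u$ for $i=(u,k)$, $j=(v,l)$; $\sum_{j\in J_h}h_{ij}h_{i'j}^*=\delta_{ii'}u$ for $i=(u,k),i'\in I_h$; $\sum_{i\in I_h}h_{ij}^*h_{ij'}=\delta_{jj'}v$ for $j=(v,l),j'\in J_h$. **Bergman presentations and Bergman graphs.** A Bergman presentation is a family $R=\{a_i=b_i\mid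 i\in I\}$ of pairs of nonzero elements of the free abelian monoid $\langle X\rangle$ ($X$, $I$ finite) with a partition $I=I_{\rm blue}\sqcup I_{\rm red}$ such that (i) for $i\in I_{\rm blue}$, $b_i$ is the sum of the elements of a set $X_i\subseteq X$ with $|X_i|\ge 2$, and the sets $X_i$ are pairwise disjoint; (ii) there is an ordering $i_1,\dots,i_m$ of $I_{\rm blue}$ such that all summands of $a_{i_k}$ lie in $X_{\rm base}\cup X_{i_1}\cup\dots\cup X_{i_{k-1}}$, where $X_{\rm base}=X\setminus\bigcup_{i\in I_{\rm blue}}X_i$. It is basic if $X=X_{\rm base}$. A Bergman graph is a hypergraph $H$ with a partition $H^1=H^1_{\rm blue}\sqcup H^1_{\rm red}$ such that $X=H^0$, $I=H^1$ and the relations $\sum_v s(h)(v)\,v=\sum_v r(h)(v)\,v$ form a Bergman presentation $\beta(H)$; $H$ is basic if $\beta(H)$ is basic. **Bergman algebras.** The Bergman algebra $B(X,R)$ is obtained from $K^{X_{\rm base}}$ by adjoining, for each blue relation $a_i=b_i$, a universal decomposition of the projective module of $a_i$ into a direct sum indexed by $X_i$, and then, for each red relation $a_i=b_i$, a universal isomorphism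 between the projective modules of $a_i$ and $b_i$. Explicitly, it is the $K$-algebra generated by the entries of matrices $\epsilon_x$ ($x\in X$) and $\sigma_i,\sigma_i'$ ($i\in I_{\rm red}$), where $\epsilon_c$ denotes the block diagonal sum of the $\epsilon_y$ over the summands $y$ of $c\in\langle X\rangle$ with multiplicity, $\epsilon_x$ is $1\times1$ for $x\in X_{\rm base}$ and has the size of $\epsilon_{a_i}$ for $x\in X_i$, subject to: $\epsilon_x\epsilon_y=\delta_{xy}\epsilon_x$ for $x,y\in X_{\rm base}$ and $\sum_{x\in X_{\rm base}}\epsilon_x=1$; $\epsilon_x\epsilon_y=\delta_{xy}\epsilon_x$ for $x,y\in X_i$ and $\sum_{x\in X_i}\epsilon_x=\epsilon_{a_i}$ for $i\in I_{\rm blue}$; $\epsilon_{a_i}\sigma_i\epsilon_{b_i}=\sigma_i$, $\epsilon_{b_i}\sigma_i'\epsilon_{a_i}=\sigma_i'$, $\sigma_i\sigma_i'=\epsilon_{a_i}$, $\sigma_i'\sigma_i=\epsilon_{b_i}$ for $i\in I_{\rm red}$. For a Bergman graph, $B(H)=B(\beta(H))$. **Theorem.** (a) Let $H$ be a basic Bergman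 graph, $v\in H^0$ a lonely vertex and $h\in H^1$ the corresponding hyperedge: $s(h)=\{v\}$ (with multiplicity one), $v$ is not a range of $h$, and $v$ is neither a source nor a range of any hyperedge $g\ne h$. Let $H'$ be the basic Bergman graph obtained from $H$ by removing $v$ and $h$. Then $B(H')$ and $B(H)$ are Morita equivalent, i.e. their module categories are equivalent ($K$-linearly). Moreover, $e=\sum_{u\in H^0\setminus\{v\}}u$ is an idempotent of $L(H)$ which is full, i.e. $L(H)eL(H)=L(H)$, and $L(H')$ is isomorphic as a $K$-algebra to the corner $eL(H)e$. (b) Let $(X,R)$ be a basic Bergman presentation, $x\in X$ a lonely generator and $i\in I$ the corresponding index: $a_i=x$, $x$ is not a summand of $b_i$, and $x$ is not a summand of $a_j$ or $b_j$ for any $j\in I\setminus\{i\}$. Let $(X',R')$ be the basic Bergman presentation obtained from $(X,R)$ by removing the generator $x$ and the relation $a_i=b_i$. Then $B(X',R')$ and $B(X,R)$ are ($K$-linearly) Morita equivalent. -/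

import Mathlib

/-! ### Hypergraphs and Leavitt path algebras of hypergraphs -/

/-- The index set `{(v, k) | 1 ≤ k ≤ m v}` of a multiset `m : V → ℕ`, that is, the occurrences of
elements in `m`. -/
structure MultIndex {V : Type*} (m : V → ℕ) where
  elt : V
  occ : Fin (m elt)

instance {V : Type*} [Finite V] (m : V → ℕ) : Finite (MultIndex m) :=
  Finite.of_surjective (fun p : (v : V) × Fin (m v) => (⟨p.1, p.2⟩ : MultIndex m))
    fun q => ⟨⟨q.elt, q.occ⟩, rfl⟩

noncomputable instance {V : Type*} [Finite V] (m : V → ℕ) : Fintype (MultIndex m) :=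
  Fintype.ofFinite _

/-- A hypergraph with vertex set `V` and hyperedge set `E`: every hyperedge has a nonempty
multiset of sources and a nonempty multiset of ranges. Finiteness of `V` and `E` is expressed by
instances `[Finite V] [Finite E]`. -/
structure OrientedHypergraph (V E : Type*) where
  s : E → V → ℕ
  r : E → V → ℕ
  s_nonempty : ∀ h, ∃ v, s h v ≠ 0
  r_nonempty : ∀ h, ∃ v, r h v ≠ 0

namespace OrientedHypergraph

variable {V E : Type*}

/-- The generators `v`, `h_{ij}`, `h_{ij}^*` of the Leavitt path algebra of a hypergraph. -/
inductive LGen (H : OrientedHypergraph V E) : Type _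
  | vert (v : V) : LGen H
  | edge (h : E) (i : MultIndex (H.s h)) (j : MultIndex (H.r h)) : LGen H
  | ghost (h : E) (i : MultIndex (H.s h)) (j : MultIndex (H.r h)) : LGen H

section Leavitt

variable [Finite V] (K : Type*) [Field K] (H : OrientedHypergraph V E)

noncomputable def preVert (v : V) : FreeAlgebra K H.LGen :=
  FreeAlgebra.ι K (LGen.vert v)

noncomputable def preEdge (h : E) (i : MultIndex (H.s h)) (j : MultIndex (H.r h)) :
    FreeAlgebra K H.LGen :=
  FreeAlgebra.ι K (LGen.edge h i j)

noncomputable def preGhost (h : E) (i : MultIndex (H.s h)) (j : MultIndex (H.r h)) :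
    FreeAlgebra K H.LGen :=
  FreeAlgebra.ι K (LGen.ghost h i j)

open Classical in
/-- The defining relations of the Leavitt path algebra. As `V` is finite, the nonunital algebra
given by the relations other than `sum_vert` is unital with unit the sum of all vertices, so that
as a unital algebra it is given by these relations together with `sum_vert`. -/
inductive LRel : FreeAlgebra K H.LGen → FreeAlgebra K H.LGen → Prop
  | vert_mul (u v : V) :
      LRel (preVert K H u * preVert K H v) (if u = v then preVert K H u else 0)
  | sum_vert : LRel (∑ᶠ v : V, preVert K H v) 1
  | vert_edge (h : E) (i : MultIndex (H.s h)) (j : MultIndex (H.r h)) :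
      LRel (preVert K H i.elt * preEdge K H h i j) (preEdge K H h i j)
  | edge_vert (h : E) (i : MultIndex (H.s h)) (j : MultIndex (H.r h)) :
      LRel (preEdge K H h i j * preVert K H j.elt) (preEdge K H h i j)
  | vert_ghost (h : E) (i : MultIndex (H.s h)) (j : MultIndex (H.r h)) :
      LRel (preVert K H j.elt * preGhost K H h i j) (preGhost K H h i j)
  | ghost_vert (h : E) (i : MultIndex (H.s h)) (j : MultIndex (H.r h)) :
      LRel (preGhost K H h i j * preVert K H i.elt) (preGhost K H h i j)
  | edge_ghost (h : E) (i i' : MultIndex (H.s h)) :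
      LRel (∑ j : MultIndex (H.r h), preEdge K H h i j * preGhost K H h i' j)
        (if i = i' then preVert K H i.elt else 0)
  | ghost_edge (h : E) (j j' : MultIndex (H.r h)) :
      LRel (∑ i : MultIndex (H.s h), preGhost K H h i j * preEdge K H h i j')
        (if j = j' then preVert K H j.elt else 0)

/-- The Leavitt path algebra `L(H)` of a hypergraph with finitely many vertices. -/
abbrev LeavittPathAlgebra : Type _ := RingQuot (LRel K H)

/-- A vertex as an element of `L(H)`. -/
noncomputable def vertL (v : V) : LeavittPathAlgebra K H :=
  RingQuot.mkAlgHom K (LRel K H) (preVert K H v)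

/-- The sum in `L(H)` of all vertices other than `v`. -/
noncomputable def coVertL (v : V) : LeavittPathAlgebra K H :=
  ∑ᶠ u : {u : V // u ≠ v}, vertL K H u.1

end Leavitt

end OrientedHypergraph

/-! ### Bergman presentations and Bergman graphs -/

/-- A presentation `⟨x ∈ X | a_i = b_i (i ∈ I)⟩` of an abelian monoid; the free abelian monoid
on `X` is `X →₀ ℕ`. -/
structure AbelianMonoidPresentation (X I : Type*) where
  a : I → X →₀ ℕ
  b : I → X →₀ ℕ

/-- The base generators with respect to a set of blue relations: those that occur in no right
hand side of a blue relation. -/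
def AbelianMonoidPresentation.baseSet {X I : Type*} (P : AbelianMonoidPresentation X I)
    (blue : Set I) : Set X :=
  {x | ∀ i ∈ blue, P.b i x = 0}

/-- A Bergman presentation (finiteness of `X` and `I` is expressed by instances). The red
relations are those which are not blue. -/
structure BergmanPresentation (X I : Type*) extends AbelianMonoidPresentation X I where
  a_ne_zero : ∀ i, a i ≠ 0
  b_ne_zero : ∀ i, b i ≠ 0
  blue : Set I
  /-- the right hand side of a blue relation is a sum of distinct generators … -/
  blue_mult : ∀ i ∈ blue, ∀ x, b i x ≤ 1
  /-- … at least two in number … -/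
  blue_card : ∀ i ∈ blue, 2 ≤ (b i).support.card
  /-- … and different blue relations have no generator of their right hand sides in common. -/
  blue_disjoint : ∀ i ∈ blue, ∀ j ∈ blue, i ≠ j → Disjoint (b i).support (b j).support
  /-- there is an admissible ordering of the blue relations. -/
  admissible : ∃ (m : ℕ) (o : Fin m ≃ blue), ∀ k : Fin m, ∀ x ∈ (a (o k)).support,
    x ∈ toAbelianMonoidPresentation.baseSet blue ∨ ∃ p < k, x ∈ (b (o p)).support

/-- A Bergman graph (finiteness of `V` and `E` is expressed by instances). The red hyperedges
are those which are not blue. -/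
structure BergmanGraph (V E : Type*) extends OrientedHypergraph V E where
  blue : Set E
  /-- the range multiset of a blue hyperedge is a set … -/
  blue_mult : ∀ h ∈ blue, ∀ v, r h v ≤ 1
  /-- … with at least two elements … -/
  blue_card : ∀ h ∈ blue, 2 ≤ (Function.support (r h)).ncard
  /-- … and different blue hyperedges have disjoint ranges. -/
  blue_disjoint : ∀ h ∈ blue, ∀ g ∈ blue, h ≠ g →
    Disjoint (Function.support (r h)) (Function.support (r g))
  /-- there is an admissible ordering of the blue hyperedges. -/
  admissible : ∃ (m : ℕ) (o : Fin m ≃ blue), ∀ k : Fin m, ∀ v ∈ Function.support (s (o k)),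
    (∀ g ∈ blue, r g v = 0) ∨ ∃ p < k, v ∈ Function.support (r (o p))

namespace BergmanPresentation

variable {X I : Type*}

/-- The set of base generators. -/
def base (P : BergmanPresentation X I) : Set X :=
  P.toAbelianMonoidPresentation.baseSet P.blue

/-- A Bergman presentation is basic if all its generators are base generators. -/
def IsBasic (P : BergmanPresentation X I) : Prop := P.base = Set.univ

theorem IsBasic.blue_eq {P : BergmanPresentation X I} (hP : P.IsBasic) (i : I) :
    i ∉ P.blue := by
  intro hi
  apply P.b_ne_zero i
  ext x
  have hx : x ∈ P.base := by rw [hP]; trivial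
  exact hx i hi

/-! ### The Bergman algebra

The idempotent matrix `ε_x` attached to a generator `x` is a `1 × 1` matrix if `x` is a base
generator, and has the size of the block diagonal matrix `ε_{a_i}` if `x` is a summand of the
right hand side `b_i` of a blue relation. Here `ε_c = ⨁ ε_y`, where `y` runs through the summands
of `c`, counted with multiplicity. -/

/-- The set of row (and column) indices of the matrix `ε_x`. -/
inductive Idx (P : BergmanPresentation X I) : X → Type _
  | base (x : X) (hx : x ∈ P.base) : Idx P x
  | step (i : I) (hi : i ∈ P.blue) (x : X) (hx : x ∈ (P.b i).support)
      (y : MultIndex (P.a i)) (p : Idx P y.elt) : Idx P x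

/-- The set of row (and column) indices of the matrix `ε_c`. -/
structure SumIdx (P : BergmanPresentation X I) (c : X →₀ ℕ) where
  summand : MultIndex c
  idx : P.Idx summand.elt

theorem finite_idx_of_mem_base (P : BergmanPresentation X I) (x : X) (hx : x ∈ P.base) :
    Finite (P.Idx x) := by
  have : Subsingleton (P.Idx x) := by
    refine ⟨fun p q => ?_⟩
    cases p with
    | step i hi _ hx' y p => exact absurd (hx i hi) (Finsupp.mem_support_iff.1 hx')
    | base =>
      cases q with
      | step i hi _ hx' y p => exact absurd (hx i hi) (Finsupp.mem_support_iff.1 hx')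
      | base => rfl
  infer_instance

theorem finite_idx [Finite X] (P : BergmanPresentation X I) (x : X) : Finite (P.Idx x) := by
  obtain ⟨m, o, ho⟩ := P.admissible
  have key : ∀ n : ℕ, ∀ k : Fin m, k.1 = n → ∀ z ∈ (P.b (o k)).support,
      Finite (P.Idx z) := by
    intro n
    induction n using Nat.strong_induction_on with
    | _ n ih =>
      intro k hk z hz
      have hfin : ∀ y : MultIndex (P.a (o k)), Finite (P.Idx y.elt) := by
        intro y
        have hy : y.elt ∈ (P.a (o k)).support := by
          rw [Finsupp.mem_support_iff]
          exact (Fin.pos y.occ).ne'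
        rcases ho k y.elt hy with h | ⟨p, hp, h⟩
        · exact P.finite_idx_of_mem_base _ h
        · exact ih p.1 (hk ▸ hp) p rfl _ h
      let f : ((y : MultIndex (P.a (o k))) × P.Idx y.elt) → P.Idx z :=
        fun q => Idx.step (P := P) (o k) (o k).2 z hz q.1 q.2
      refine Finite.of_surjective f ?_
      intro q
      cases q with
      | base _ hb => exact absurd (hb (o k) (o k).2) (Finsupp.mem_support_iff.1 hz)
      | step i hi _ hx y p =>
        have : i = (o k : I) := by
          by_contra hne
          exact Finset.disjoint_left.1 (P.blue_disjoint i hi _ (o k).2 hne) hx hz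
        subst this
        exact ⟨⟨y, p⟩, rfl⟩
  by_cases hx : x ∈ P.base
  · exact P.finite_idx_of_mem_base x hx
  · have : ∃ i ∈ P.blue, P.b i x ≠ 0 := by
      by_contra hcon
      apply hx
      intro i hi
      by_contra h
      exact hcon ⟨i, hi, h⟩
    obtain ⟨i, hi, h⟩ := this
    refine key _ (o.symm ⟨i, hi⟩) rfl x ?_
    simpa using h

section BergmanAlgebra

variable [Finite X]

instance (P : BergmanPresentation X I) (x : X) : Finite (P.Idx x) := P.finite_idx x

instance (P : BergmanPresentation X I) (c : X →₀ ℕ) : Finite (P.SumIdx c) :=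
  Finite.of_surjective (fun p : (y : MultIndex c) × P.Idx y.elt => (⟨p.1, p.2⟩ : P.SumIdx c))
    fun q => ⟨⟨q.summand, q.idx⟩, rfl⟩

noncomputable instance (P : BergmanPresentation X I) (c : X →₀ ℕ) : Fintype (P.SumIdx c) :=
  Fintype.ofFinite _

/-- The generators of the Bergman algebra: the entries of the matrices `ε_x` for `x ∈ X`, and the
entries of the matrices `σ_i` and `σ'_i` for the red relations `a_i = b_i`. -/
inductive BGen (P : BergmanPresentation X I) : Type _
  | eps (x : X) (p q : P.Idx x) : BGen P
  | sig (i : I) (hi : i ∉ P.blue) (p : P.SumIdx (P.a i)) (q : P.SumIdx (P.b i)) : BGen P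
  | sig' (i : I) (hi : i ∉ P.blue) (p : P.SumIdx (P.b i)) (q : P.SumIdx (P.a i)) : BGen P

section Algebra

variable (K : Type*) [Field K] (P : BergmanPresentation X I)

/-- The only entry of the `1 × 1` matrix `ε_x` of a base generator `x`. -/
noncomputable def epsBase (x : P.base) : FreeAlgebra K P.BGen :=
  FreeAlgebra.ι K (BGen.eps x.1 (Idx.base x.1 x.2) (Idx.base x.1 x.2))

/-- The matrix `ε_x` of a summand `x` of the right hand side of the `i`-th relation (blue), its
rows and columns being indexed like those of `ε_{a_i}`. -/
noncomputable def epsBlue (i : I) (hi : i ∈ P.blue) (x : (P.b i).support) :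
    Matrix (P.SumIdx (P.a i)) (P.SumIdx (P.a i)) (FreeAlgebra K P.BGen) :=
  Matrix.of fun p q => FreeAlgebra.ι K
    (BGen.eps x.1 (Idx.step i hi x.1 x.2 p.summand p.idx)
      (Idx.step i hi x.1 x.2 q.summand q.idx))

open Classical in
/-- The block diagonal matrix `ε_c`. -/
noncomputable def epsSum (c : X →₀ ℕ) :
    Matrix (P.SumIdx c) (P.SumIdx c) (FreeAlgebra K P.BGen) :=
  Matrix.of fun p q =>
    if hpq : q.summand = p.summand then
      FreeAlgebra.ι K (BGen.eps p.summand.elt p.idx (hpq ▸ q.idx))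
    else 0

noncomputable def sigma (i : I) (hi : i ∉ P.blue) :
    Matrix (P.SumIdx (P.a i)) (P.SumIdx (P.b i)) (FreeAlgebra K P.BGen) :=
  Matrix.of fun p q => FreeAlgebra.ι K (BGen.sig i hi p q)

noncomputable def sigma' (i : I) (hi : i ∉ P.blue) :
    Matrix (P.SumIdx (P.b i)) (P.SumIdx (P.a i)) (FreeAlgebra K P.BGen) :=
  Matrix.of fun p q => FreeAlgebra.ι K (BGen.sig' i hi p q)

open Classical in
/-- The defining relations of the Bergman algebra. The first two give `K^{X_base}`; the next two
adjoin, for every blue relation, a universal decomposition of the projective module of `ε_{a_i}`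
into a direct sum indexed by the summands of `b_i`; the others adjoin, for every red relation, a
universal isomorphism between the projective modules of `ε_{a_i}` and `ε_{b_i}`. -/
inductive BRel : FreeAlgebra K P.BGen → FreeAlgebra K P.BGen → Prop
  | base_mul (x y : P.base) :
      BRel (epsBase K P x * epsBase K P y) (if x = y then epsBase K P x else 0)
  | base_sum : BRel (∑ᶠ x : P.base, epsBase K P x) 1
  | blue_mul (i : I) (hi : i ∈ P.blue) (x y : (P.b i).support) (p q : P.SumIdx (P.a i)) :
      BRel ((epsBlue K P i hi x * epsBlue K P i hi y) p q)
        (if x = y then epsBlue K P i hi x p q else 0)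
  | blue_sum (i : I) (hi : i ∈ P.blue) (p q : P.SumIdx (P.a i)) :
      BRel (∑ x : (P.b i).support, epsBlue K P i hi x p q) (epsSum K P (P.a i) p q)
  | red_sigma (i : I) (hi : i ∉ P.blue) (p : P.SumIdx (P.a i)) (q : P.SumIdx (P.b i)) :
      BRel ((epsSum K P (P.a i) * sigma K P i hi * epsSum K P (P.b i)) p q)
        (sigma K P i hi p q)
  | red_sigma' (i : I) (hi : i ∉ P.blue) (p : P.SumIdx (P.b i)) (q : P.SumIdx (P.a i)) :
      BRel ((epsSum K P (P.b i) * sigma' K P i hi * epsSum K P (P.a i)) p q)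
        (sigma' K P i hi p q)
  | red_left (i : I) (hi : i ∉ P.blue) (p q : P.SumIdx (P.a i)) :
      BRel ((sigma K P i hi * sigma' K P i hi) p q) (epsSum K P (P.a i) p q)
  | red_right (i : I) (hi : i ∉ P.blue) (p q : P.SumIdx (P.b i)) :
      BRel ((sigma' K P i hi * sigma K P i hi) p q) (epsSum K P (P.b i) p q)

/-- The Bergman algebra `B(X, R)` of a Bergman presentation. -/
abbrev BergmanAlgebra : Type _ := RingQuot (BRel K P)

end Algebra

end BergmanAlgebra

/-! ### Lonely generator elimination -/

/-- `x` is a lonely generator, and the `i`-th relation is the one of the form `x = b_i`. -/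
structure IsLonely (P : BergmanPresentation X I) (x : X) (i : I) : Prop where
  left_eq : P.a i = Finsupp.single x 1
  right_eq : P.b i x = 0
  other : ∀ j, j ≠ i → P.a j x = 0 ∧ P.b j x = 0

theorem subtypeDomain_ne_zero {x : X} {c : X →₀ ℕ} (hc : c ≠ 0) (hx : c x = 0) :
    c.subtypeDomain (fun y => y ≠ x) ≠ 0 := by
  intro h
  apply hc
  ext y
  by_cases hy : y = x
  · rw [hy, hx]; rfl
  · exact DFunLike.congr_fun h ⟨y, hy⟩

/-- Lonely generator elimination: the lonely generator `x` and the `i`-th relation are removed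
from the basic Bergman presentation `P`. -/
noncomputable def eliminate (P : BergmanPresentation X I) (hP : P.IsBasic) {x : X} {i : I}
    (hx : P.IsLonely x i) : BergmanPresentation {y : X // y ≠ x} {j : I // j ≠ i} where
  a j := (P.a j.1).subtypeDomain (fun y => y ≠ x)
  b j := (P.b j.1).subtypeDomain (fun y => y ≠ x)
  a_ne_zero j := subtypeDomain_ne_zero (P.a_ne_zero j.1) (hx.other j.1 j.2).1
  b_ne_zero j := subtypeDomain_ne_zero (P.b_ne_zero j.1) (hx.other j.1 j.2).2
  blue := {j | j.1 ∈ P.blue}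
  blue_mult j hj := absurd hj (hP.blue_eq j.1)
  blue_card j hj := absurd hj (hP.blue_eq j.1)
  blue_disjoint j hj := absurd hj (hP.blue_eq j.1)
  admissible := by
    have : IsEmpty ({j | j.1 ∈ P.blue} : Set {j : I // j ≠ i}) := ⟨fun j => hP.blue_eq _ j.2⟩
    exact ⟨0, Equiv.equivOfIsEmpty _ _, fun k => k.elim0⟩

end BergmanPresentation

namespace BergmanGraph

variable {V E : Type*}

/-- The set of base vertices. -/
def base (H : BergmanGraph V E) : Set V := {v | ∀ h ∈ H.blue, H.r h v = 0}

/-- A Bergman graph is basic if all its vertices are base vertices. -/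
def IsBasic (H : BergmanGraph V E) : Prop := H.base = Set.univ

theorem IsBasic.blue_eq {H : BergmanGraph V E} (hH : H.IsBasic) (h : E) : h ∉ H.blue := by
  intro hh
  obtain ⟨v, hv⟩ := H.r_nonempty h
  have hb : v ∈ H.base := by rw [hH]; trivial
  exact hv (hb h hh)

/-- The Bergman presentation `β(H)` corresponding to a Bergman graph `H`: the generators are the
vertices, and for every hyperedge `h` there is the relation `∑ s(h) = ∑ r(h)`. -/
noncomputable def toPresentation [Finite V] (H : BergmanGraph V E) :
    BergmanPresentation V E where
  a h := Finsupp.equivFunOnFinite.symm (H.s h)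
  b h := Finsupp.equivFunOnFinite.symm (H.r h)
  a_ne_zero h hz := by
    obtain ⟨v, hv⟩ := H.s_nonempty h
    exact hv (DFunLike.congr_fun hz v)
  b_ne_zero h hz := by
    obtain ⟨v, hv⟩ := H.r_nonempty h
    exact hv (DFunLike.congr_fun hz v)
  blue := H.blue
  blue_mult := H.blue_mult
  blue_card h hh := by
    rw [← Set.ncard_coe_finset, ← Finsupp.fun_support_eq]
    exact H.blue_card h hh
  blue_disjoint h hh g hg hne := by
    rw [← Finset.disjoint_coe, ← Finsupp.fun_support_eq, ← Finsupp.fun_support_eq]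
    exact H.blue_disjoint h hh g hg hne
  admissible := by
    obtain ⟨m, o, ho⟩ := H.admissible
    refine ⟨m, o, fun k v hv => ?_⟩
    rcases ho k v (Finsupp.mem_support_iff.1 hv) with h | ⟨p, hp, h⟩
    · exact Or.inl h
    · exact Or.inr ⟨p, hp, Finsupp.mem_support_iff.2 h⟩

/-- The Bergman algebra `B(H)` of a Bergman graph. -/
abbrev BergmanAlgebra [Finite V] (K : Type*) [Field K] (H : BergmanGraph V E) : Type _ :=
  BergmanPresentation.BergmanAlgebra K H.toPresentation

/-! ### Lonely vertex elimination -/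

/-- `v` is a lonely vertex, and `h` is the hyperedge with `s(h) = {v}`. -/
structure IsLonely (H : BergmanGraph V E) (v : V) (h : E) : Prop where
  source_self : H.s h v = 1
  source_ne : ∀ u, u ≠ v → H.s h u = 0
  not_range : H.r h v = 0
  other : ∀ g, g ≠ h → H.s g v = 0 ∧ H.r g v = 0

/-- Lonely vertex elimination: the lonely vertex `v` and the hyperedge `h` with source `v` are
removed from the basic Bergman graph `H`. -/
def eliminate (H : BergmanGraph V E) (hH : H.IsBasic) {v : V} {h : E} (hv : H.IsLonely v h) :
    BergmanGraph {u : V // u ≠ v} {g : E // g ≠ h} where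
  s g u := H.s g.1 u.1
  r g u := H.r g.1 u.1
  s_nonempty g := by
    obtain ⟨u, hu⟩ := H.s_nonempty g.1
    exact ⟨⟨u, fun e => hu (e ▸ (hv.other g.1 g.2).1)⟩, hu⟩
  r_nonempty g := by
    obtain ⟨u, hu⟩ := H.r_nonempty g.1
    exact ⟨⟨u, fun e => hu (e ▸ (hv.other g.1 g.2).2)⟩, hu⟩
  blue := {g | g.1 ∈ H.blue}
  blue_mult g hg := absurd hg (hH.blue_eq g.1)
  blue_card g hg := absurd hg (hH.blue_eq g.1)
  blue_disjoint g hg := absurd hg (hH.blue_eq g.1)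
  admissible := by
    have : IsEmpty ({g | g.1 ∈ H.blue} : Set {g : E // g ≠ h}) := ⟨fun g => hH.blue_eq _ g.2⟩
    exact ⟨0, Equiv.equivOfIsEmpty _ _, fun k => k.elim0⟩

end BergmanGraph

/-! Write `J` for the set of ranges of the lonely hyperedge `h`. Since `h` has a single source `v`,
its generators form a row `(h_j)` with `∑ h_j h_j^* = v` and `h_j^* h_j' = δ_{jj'} r(j)`. They
identify the projective module of `v` with the direct sum of those of the ranges of `h`, all of
which lie under `e = 1 - v`. So `v` contributes nothing new up to Morita equivalence: `1 = e e e + ∑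
h_j e h_j^*` shows that `e` is full.

Sending generators to generators gives a map from `L(H')` to `L(H)` with unit `e` (`cornerHom`). It
is injective because `L(H)` acts by matrices over `L(H')` indexed by `none` and `J`: the generators
of `H'` sit in the corner `(none, none)`, `v` becomes the diagonal matrix of the ranges of `h`, and
`h_j`, `h_j^*` become single entries at `(j, none)` and `(none, j)` (`LeavittFamily.extend`).
Composing the two maps gives `a ↦ a E_{none,none}` (`lift_extend_cornerHom`). It is onto `e L(H) e`
because every product `col p * b * row q` lies in its range, where `row = (e, h_j)` and `col = (e,
h_j^*)`. This passes from factors to products by inserting `1 = ∑ row r * col r`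
(`col_mul_mul_row_mem`).

An algebra is Morita equivalent to a full corner through `M ↦ eM`
(`FullCornerHom.isMoritaEquivalent`). Finally, a basic presentation has no blue relations and all
its matrices `ε_x` are `1 × 1`, so its Bergman algebra is the Leavitt path algebra of its hypergraph
(`leavittEquiv`). This transfers the result to Bergman algebras.

The intermediate families of generators need not sum to `1`: in `L(H)` those of `H'` sum to `e`.
Hence the universal property is also needed for nonunital homomorphisms, obtained by mapping into
the corner of the sum. -/

/-! ### Corners of algebras -/

namespace IsIdempotentElem.Corner

variable {A : Type*} [Ring A] {e : A} (he : IsIdempotentElem e)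

/-- The inclusion of a corner `eAe` into `A`, as an additive and multiplicative map. -/
def incl : he.Corner →ₙ+* A where
  toFun x := x.1
  map_mul' _ _ := rfl
  map_zero' := rfl
  map_add' _ _ := rfl

theorem incl_injective : Function.Injective (incl he) := Subtype.val_injective

@[simp] theorem incl_one : incl he 1 = e := rfl

/-- The element of the corner `eAe` given by an element of `A` that is fixed by `e` from both
sides. -/
def ofFixed (x : A) (h₁ : e * x = x) (h₂ : x * e = x) : he.Corner :=
  ⟨x, (Subsemigroup.mem_corner_iff he).2 ⟨h₁, h₂⟩⟩

@[simp] theorem incl_ofFixed (x : A) (h₁ : e * x = x) (h₂ : x * e = x) :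
    incl he (ofFixed he x h₁ h₂) = x := rfl

variable {K : Type*} [CommSemiring K] [Algebra K A]

instance : SMul K he.Corner where
  smul k x := ofFixed he (k • x.1)
    (by rw [mul_smul_comm, ((Subsemigroup.mem_corner_iff he).1 x.2).1])
    (by rw [smul_mul_assoc, ((Subsemigroup.mem_corner_iff he).1 x.2).2])

@[simp] theorem incl_smul (k : K) (x : he.Corner) : incl he (k • x) = k • incl he x := rfl

theorem mul_incl (x : he.Corner) : e * incl he x = incl he x :=
  ((Subsemigroup.mem_corner_iff he).1 x.2).1

theorem incl_mul (x : he.Corner) : incl he x * e = incl he x :=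
  ((Subsemigroup.mem_corner_iff he).1 x.2).2

/-- The unit of the corner is `e`, so scalars embed as `k • e`; the inclusion into `A` is therefore
only a nonunital homomorphism. -/
instance : Algebra K he.Corner where
  algebraMap :=
    { toFun k := k • (1 : he.Corner)
      map_one' := incl_injective he (by simp)
      map_mul' k l := incl_injective he (by
        simp [he.eq, mul_smul, smul_comm k l])
      map_zero' := incl_injective he (by simp)
      map_add' k l := incl_injective he (by simp [add_smul]) }
  commutes' k x := incl_injective he (by
    change incl he (k • (1 : he.Corner) * x) = incl he (x * k • (1 : he.Corner))
    simp [mul_incl, incl_mul])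
  smul_def' k x := incl_injective he (by
    change incl he (k • x) = incl he (k • (1 : he.Corner) * x)
    simp [mul_incl])

/-- The inclusion of a corner `eAe` into `A` as a homomorphism of nonunital algebras. -/
def inclAlg : he.Corner →ₙₐ[K] A :=
  { incl he with map_smul' := incl_smul he }

end IsIdempotentElem.Corner

/-! ### The universal property of Leavitt path algebras -/

namespace OrientedHypergraph

variable {V E : Type*} [Finite V]

open Classical in
/-- A family of elements of a nonunital ring that satisfies the defining relations of the Leavitt
path algebra of a hypergraph, except possibly for the one asserting that the sum of the vertices
is a unit. -/
structure LeavittFamily (H : OrientedHypergraph V E) (A : Type*) [NonUnitalSemiring A] where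
  vert : V → A
  edge : ∀ h, MultIndex (H.s h) → MultIndex (H.r h) → A
  ghost : ∀ h, MultIndex (H.s h) → MultIndex (H.r h) → A
  vert_mul : ∀ u v, vert u * vert v = if u = v then vert u else 0
  vert_edge : ∀ h i j, vert i.elt * edge h i j = edge h i j
  edge_vert : ∀ h i j, edge h i j * vert j.elt = edge h i j
  vert_ghost : ∀ h i j, vert j.elt * ghost h i j = ghost h i j
  ghost_vert : ∀ h i j, ghost h i j * vert i.elt = ghost h i j
  edge_ghost : ∀ h i i', ∑ j, edge h i j * ghost h i' j = if i = i' then vert i.elt else 0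
  ghost_edge : ∀ h j j', ∑ i, ghost h i j * edge h i j' = if j = j' then vert j.elt else 0

namespace LeavittFamily

variable {H : OrientedHypergraph V E} {A : Type*}

section NonUnital

variable [NonUnitalSemiring A] (F : LeavittFamily H A)

/-- The sum of the vertices of a Leavitt family. -/
noncomputable def unit : A := ∑ᶠ v, F.vert v

theorem vert_self (v : V) : F.vert v * F.vert v = F.vert v := by
  rw [F.vert_mul, if_pos rfl]

theorem unit_mul_vert (v : V) : F.unit * F.vert v = F.vert v := by
  classical
  have := Fintype.ofFinite V
  simp [unit, finsum_eq_sum_of_fintype, Finset.sum_mul, F.vert_mul]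

theorem vert_mul_unit (v : V) : F.vert v * F.unit = F.vert v := by
  classical
  have := Fintype.ofFinite V
  simp [unit, finsum_eq_sum_of_fintype, Finset.mul_sum, F.vert_mul]

theorem isIdempotentElem_unit : IsIdempotentElem F.unit := by
  have := Fintype.ofFinite V
  change F.unit * F.unit = F.unit
  conv_lhs => enter [2]; rw [unit]
  simp only [finsum_eq_sum_of_fintype, Finset.mul_sum, F.unit_mul_vert]
  rw [unit, finsum_eq_sum_of_fintype]

theorem unit_mul_edge (h : E) (i : MultIndex (H.s h)) (j : MultIndex (H.r h)) :
    F.unit * F.edge h i j = F.edge h i j := by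
  rw [← F.vert_edge, ← mul_assoc, F.unit_mul_vert]

theorem edge_mul_unit (h : E) (i : MultIndex (H.s h)) (j : MultIndex (H.r h)) :
    F.edge h i j * F.unit = F.edge h i j := by
  rw [← F.edge_vert, mul_assoc, F.vert_mul_unit]

theorem unit_mul_ghost (h : E) (i : MultIndex (H.s h)) (j : MultIndex (H.r h)) :
    F.unit * F.ghost h i j = F.ghost h i j := by
  rw [← F.vert_ghost, ← mul_assoc, F.unit_mul_vert]

theorem ghost_mul_unit (h : E) (i : MultIndex (H.s h)) (j : MultIndex (H.r h)) :
    F.ghost h i j * F.unit = F.ghost h i j := by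
  rw [← F.ghost_vert, mul_assoc, F.vert_mul_unit]

end NonUnital

section Unital

variable (K : Type*) [Field K] [Ring A] [Algebra K A] (F : LeavittFamily H A)

/-- The value of a Leavitt family at a generator. -/
def gen : H.LGen → A
  | .vert v => F.vert v
  | .edge h i j => F.edge h i j
  | .ghost h i j => F.ghost h i j

/-- A Leavitt family whose vertices sum up to `1` induces a homomorphism of algebras on the
Leavitt path algebra. -/
noncomputable def liftUnital (hF : F.unit = 1) : LeavittPathAlgebra K H →ₐ[K] A :=
  RingQuot.liftAlgHom K ⟨FreeAlgebra.lift K F.gen, by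
    classical
    have := Fintype.ofFinite V
    intro x y hxy
    induction hxy with
    | vert_mul u v =>
      rw [apply_ite (FreeAlgebra.lift K F.gen)]
      simpa [preVert, gen] using F.vert_mul u v
    | sum_vert =>
      rw [map_one, ← hF]
      simp [preVert, gen, unit, finsum_eq_sum_of_fintype]
    | vert_edge h i j => simpa [preVert, preEdge, gen] using F.vert_edge h i j
    | edge_vert h i j => simpa [preVert, preEdge, gen] using F.edge_vert h i j
    | vert_ghost h i j => simpa [preVert, preGhost, gen] using F.vert_ghost h i j
    | ghost_vert h i j => simpa [preVert, preGhost, gen] using F.ghost_vert h i j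
    | edge_ghost h i i' =>
      rw [apply_ite (FreeAlgebra.lift K F.gen)]
      simpa [preVert, preEdge, preGhost, gen] using F.edge_ghost h i i'
    | ghost_edge h j j' =>
      rw [apply_ite (FreeAlgebra.lift K F.gen)]
      simpa [preVert, preEdge, preGhost, gen] using F.ghost_edge h j j'⟩

theorem liftUnital_mk (hF : F.unit = 1) (g : H.LGen) :
    F.liftUnital K hF (RingQuot.mkAlgHom K (LRel K H) (FreeAlgebra.ι K g)) = F.gen g := by
  rw [liftUnital, RingQuot.liftAlgHom_mkAlgHom_apply, FreeAlgebra.lift_ι_apply]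

open IsIdempotentElem.Corner in
/-- A Leavitt family as a family in the corner of its unit. -/
noncomputable def toCorner : LeavittFamily H F.isIdempotentElem_unit.Corner where
  vert v := ofFixed _ (F.vert v) (F.unit_mul_vert v) (F.vert_mul_unit v)
  edge h i j := ofFixed _ (F.edge h i j) (F.unit_mul_edge h i j) (F.edge_mul_unit h i j)
  ghost h i j := ofFixed _ (F.ghost h i j) (F.unit_mul_ghost h i j) (F.ghost_mul_unit h i j)
  vert_mul u v := incl_injective _ (by rw [apply_ite (incl _)]; simpa using F.vert_mul u v)
  vert_edge h i j := incl_injective _ (by simpa using F.vert_edge h i j)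
  edge_vert h i j := incl_injective _ (by simpa using F.edge_vert h i j)
  vert_ghost h i j := incl_injective _ (by simpa using F.vert_ghost h i j)
  ghost_vert h i j := incl_injective _ (by simpa using F.ghost_vert h i j)
  edge_ghost h i i' := incl_injective _ (by
    rw [apply_ite (incl _)]; simpa using F.edge_ghost h i i')
  ghost_edge h j j' := incl_injective _ (by
    rw [apply_ite (incl _)]; simpa using F.ghost_edge h j j')

open IsIdempotentElem.Corner in
-- Inside its own corner any family satisfies the missing relation, so the unital universal property
-- applies there.
theorem unit_toCorner : F.toCorner.unit = 1 := incl_injective _ (by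
  have := Fintype.ofFinite V
  change incl _ (∑ᶠ v, F.toCorner.vert v) = ∑ᶠ v, F.vert v
  rw [finsum_eq_sum_of_fintype, map_sum, finsum_eq_sum_of_fintype]
  rfl)

/-- The homomorphism of nonunital algebras on the Leavitt path algebra induced by a Leavitt
family. -/
noncomputable def lift : LeavittPathAlgebra K H →ₙₐ[K] A :=
  (IsIdempotentElem.Corner.inclAlg F.isIdempotentElem_unit).comp
    (F.toCorner.liftUnital K F.unit_toCorner : LeavittPathAlgebra K H →ₙₐ[K] _)

theorem lift_mk (g : H.LGen) :
    F.lift K (RingQuot.mkAlgHom K (LRel K H) (FreeAlgebra.ι K g)) = F.gen g := by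
  change IsIdempotentElem.Corner.incl _ (F.toCorner.liftUnital K F.unit_toCorner _) = _
  rw [liftUnital_mk]
  cases g <;> rfl

end Unital

end LeavittFamily

/-! ### The tautological family and induction on generators -/

variable (K : Type*) [Field K] (H : OrientedHypergraph V E)

/-- The generators of the Leavitt path algebra as a Leavitt family. -/
noncomputable def leavittFamily : LeavittFamily H (LeavittPathAlgebra K H) where
  vert v := RingQuot.mkAlgHom K (LRel K H) (preVert K H v)
  edge h i j := RingQuot.mkAlgHom K (LRel K H) (preEdge K H h i j)
  ghost h i j := RingQuot.mkAlgHom K (LRel K H) (preGhost K H h i j)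
  vert_mul u v := by
    classical
    have := RingQuot.mkAlgHom_rel K (LRel.vert_mul (K := K) (H := H) u v)
    rw [apply_ite (RingQuot.mkAlgHom K (LRel K H))] at this
    simpa only [map_mul, map_zero] using this
  vert_edge h i j := by
    simpa only [map_mul] using RingQuot.mkAlgHom_rel K (LRel.vert_edge (K := K) (H := H) h i j)
  edge_vert h i j := by
    simpa only [map_mul] using RingQuot.mkAlgHom_rel K (LRel.edge_vert (K := K) (H := H) h i j)
  vert_ghost h i j := by
    simpa only [map_mul] using RingQuot.mkAlgHom_rel K (LRel.vert_ghost (K := K) (H := H) h i j)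
  ghost_vert h i j := by
    simpa only [map_mul] using RingQuot.mkAlgHom_rel K (LRel.ghost_vert (K := K) (H := H) h i j)
  edge_ghost h i i' := by
    classical
    have := RingQuot.mkAlgHom_rel K (LRel.edge_ghost (K := K) (H := H) h i i')
    rw [apply_ite (RingQuot.mkAlgHom K (LRel K H))] at this
    simpa only [map_mul, map_zero, map_sum] using this
  ghost_edge h j j' := by
    classical
    have := RingQuot.mkAlgHom_rel K (LRel.ghost_edge (K := K) (H := H) h j j')
    rw [apply_ite (RingQuot.mkAlgHom K (LRel K H))] at this
    simpa only [map_mul, map_zero, map_sum] using this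

theorem unit_leavittFamily : (H.leavittFamily K).unit = 1 := by
  have := Fintype.ofFinite V
  have h := RingQuot.mkAlgHom_rel K (LRel.sum_vert (K := K) (H := H))
  simp only [finsum_eq_sum_of_fintype, map_sum, map_one] at h
  rw [LeavittFamily.unit, finsum_eq_sum_of_fintype]
  exact h

theorem sum_vert_leavittFamily [Fintype V] : ∑ v, (H.leavittFamily K).vert v = 1 := by
  rw [← unit_leavittFamily, LeavittFamily.unit, finsum_eq_sum_of_fintype]

section Lift

variable {H} {A : Type*} [Ring A] [Algebra K A] (F : LeavittFamily H A)

@[simp] theorem lift_vert (v : V) : F.lift K ((H.leavittFamily K).vert v) = F.vert v :=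
  F.lift_mk K (.vert v)

@[simp] theorem lift_edge (h : E) (i : MultIndex (H.s h)) (j : MultIndex (H.r h)) :
    F.lift K ((H.leavittFamily K).edge h i j) = F.edge h i j :=
  F.lift_mk K (.edge h i j)

@[simp] theorem lift_ghost (h : E) (i : MultIndex (H.s h)) (j : MultIndex (H.r h)) :
    F.lift K ((H.leavittFamily K).ghost h i j) = F.ghost h i j :=
  F.lift_mk K (.ghost h i j)

@[simp] theorem liftUnital_vert (hF : F.unit = 1) (v : V) :
    F.liftUnital K hF ((H.leavittFamily K).vert v) = F.vert v :=
  F.liftUnital_mk K hF (.vert v)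

@[simp] theorem liftUnital_edge (hF : F.unit = 1) (h : E) (i : MultIndex (H.s h))
    (j : MultIndex (H.r h)) :
    F.liftUnital K hF ((H.leavittFamily K).edge h i j) = F.edge h i j :=
  F.liftUnital_mk K hF (.edge h i j)

@[simp] theorem liftUnital_ghost (hF : F.unit = 1) (h : E) (i : MultIndex (H.s h))
    (j : MultIndex (H.r h)) :
    F.liftUnital K hF ((H.leavittFamily K).ghost h i j) = F.ghost h i j :=
  F.liftUnital_mk K hF (.ghost h i j)

end Lift

/-- The generators span the Leavitt path algebra as a nonunital algebra. -/
theorem leavitt_induction {p : LeavittPathAlgebra K H → Prop}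
    (vert : ∀ v, p ((H.leavittFamily K).vert v))
    (edge : ∀ h i j, p ((H.leavittFamily K).edge h i j))
    (ghost : ∀ h i j, p ((H.leavittFamily K).ghost h i j))
    (zero : p 0) (add : ∀ a b, p a → p b → p (a + b)) (mul : ∀ a b, p a → p b → p (a * b))
    (smul : ∀ (k : K) a, p a → p (k • a)) (a : LeavittPathAlgebra K H) : p a := by
  have := Fintype.ofFinite V
  obtain ⟨a, rfl⟩ := RingQuot.mkAlgHom_surjective K (LRel K H) a
  induction a using FreeAlgebra.induction with
  | grade0 k =>
    -- As `1` is the sum of the vertices, scalars need no case of their own; this makes the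
    -- induction applicable to nonunital maps.
    rw [AlgHom.commutes, Algebra.algebraMap_eq_smul_one, ← sum_vert_leavittFamily]
    exact smul _ _ (Finset.sum_induction _ p add zero fun v _ => vert v)
  | grade1 x =>
    cases x with
    | vert v => exact vert v
    | edge h i j => exact edge h i j
    | ghost h i j => exact ghost h i j
  | mul a b ha hb => rw [map_mul]; exact mul _ _ ha hb
  | add a b ha hb => rw [map_add]; exact add _ _ ha hb

end OrientedHypergraph

/-! ### Morita equivalence of an algebra and a full corner -/

section FullCorner

open CategoryTheory

universe w u v

variable {K : Type w} [Field K] {A B : Type u} [Ring A] [Algebra K A] [Ring B] [Algebra K B]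

/-- An identification of an algebra `A` with the corner `eBe` of an algebra `B`, together with
elements showing that the idempotent `e` is full. -/
structure FullCornerHom (K : Type w) [Field K] (A B : Type u) [Ring A] [Algebra K A] [Ring B]
    [Algebra K B] where
  toHom : A →ₙₐ[K] B
  e : B
  idem : IsIdempotentElem e
  injective : Function.Injective toHom
  range_eq : Set.range toHom = {x | ∃ a, x = e * a * e}
  ι : Type v
  [fintype : Fintype ι]
  left : ι → B
  right : ι → B
  sum_eq : ∑ k, left k * e * right k = 1

namespace FullCornerHom

attribute [instance] FullCornerHom.fintype

variable (φ : FullCornerHom.{w, u, v} K A B)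

theorem mul_apply (a : A) : φ.e * φ.toHom a = φ.toHom a := by
  obtain ⟨b, hb⟩ : φ.toHom a ∈ {x | ∃ a, x = φ.e * a * φ.e} := φ.range_eq ▸ ⟨a, rfl⟩
  rw [hb, ← mul_assoc, ← mul_assoc, φ.idem.eq]

theorem apply_mul (a : A) : φ.toHom a * φ.e = φ.toHom a := by
  obtain ⟨b, hb⟩ : φ.toHom a ∈ {x | ∃ a, x = φ.e * a * φ.e} := φ.range_eq ▸ ⟨a, rfl⟩
  rw [hb, mul_assoc, φ.idem.eq]

theorem exists_apply (b : B) : ∃ a, φ.toHom a = φ.e * b * φ.e :=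
  φ.range_eq.ge ⟨b, rfl⟩

/-- If `e` is the image of `a`, then `φ(1) = φ(1) e = φ(1) φ(a) = φ(a) = e`; no unitality has to be
assumed. -/
theorem map_one : φ.toHom 1 = φ.e := by
  obtain ⟨a, ha⟩ := φ.exists_apply 1
  rw [mul_one, φ.idem.eq] at ha
  rw [← φ.apply_mul 1, ← ha, ← map_mul, one_mul]

/-! ### The assignment `M ↦ eM` and its full faithfulness -/

section Obj

variable (M : Type*) [AddCommGroup M] [Module B M]

/-- The subgroup `eM` of a `B`-module `M`. -/
def part : AddSubgroup M where
  carrier := {m | φ.e • m = m}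
  zero_mem' := smul_zero _
  add_mem' {a b} ha hb := by
    simp only [Set.mem_ofPred_eq] at *
    rw [smul_add, ha, hb]
  neg_mem' {a} ha := by
    simp only [Set.mem_ofPred_eq] at *
    rw [smul_neg, ha]

variable {M} in
theorem mem_part {m : M} : m ∈ φ.part M ↔ φ.e • m = m := Iff.rfl

instance : Module A (φ.part M) where
  smul a m := ⟨φ.toHom a • m.1, by rw [mem_part, ← mul_smul, φ.mul_apply]⟩
  one_smul m := Subtype.ext (by
    change φ.toHom 1 • m.1 = m.1
    rw [map_one]; exact m.2)
  mul_smul a b m := Subtype.ext (by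
    change φ.toHom (a * b) • m.1 = φ.toHom a • φ.toHom b • m.1
    rw [map_mul, mul_smul])
  smul_zero a := Subtype.ext (smul_zero (φ.toHom a))
  smul_add a m n := Subtype.ext (smul_add (φ.toHom a) m.1 n.1)
  add_smul a b m := Subtype.ext (by
    change φ.toHom (a + b) • m.1 = φ.toHom a • m.1 + φ.toHom b • m.1
    rw [map_add, add_smul])
  zero_smul m := Subtype.ext (by
    change φ.toHom 0 • m.1 = 0
    rw [map_zero, zero_smul])

@[simp] theorem coe_smul_part (a : A) (m : φ.part M) : (a • m).1 = φ.toHom a • m.1 := rfl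

variable {M}

/-- The element `em` of `eM`. -/
def proj (m : M) : φ.part M := ⟨φ.e • m, by rw [mem_part, ← mul_smul, φ.idem.eq]⟩

@[simp] theorem coe_proj (m : M) : (φ.proj m).1 = φ.e • m := rfl

theorem proj_add (m n : M) : φ.proj (m + n) = φ.proj m + φ.proj n :=
  Subtype.ext (smul_add _ _ _)

variable {N : Type*} [AddCommGroup N] [Module B N]

/-- The restriction of a `B`-linear map `M → N` to an `A`-linear map `eM → eN`. -/
def partMap (f : M →ₗ[B] N) : φ.part M →ₗ[A] φ.part N where
  toFun m := ⟨f m.1, by rw [mem_part, ← map_smul, φ.mem_part.1 m.2]⟩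
  map_add' m n := Subtype.ext (map_add f m.1 n.1)
  map_smul' a m := Subtype.ext (map_smul f (φ.toHom a) m.1)

/-- Fullness in the form used below: every `m` is recovered from the elements `e • right k • m` of
`eM`. -/
theorem sum_smul (m : M) : ∑ k, φ.left k • φ.e • φ.right k • m = m := by
  simp_rw [← mul_smul, ← Finset.sum_smul, ← mul_assoc, φ.sum_eq, one_smul]

theorem partMap_injective {f g : M →ₗ[B] N} (h : φ.partMap f = φ.partMap g) : f = g := by
  ext m
  have key : ∀ k, f (φ.e • φ.right k • m) = g (φ.e • φ.right k • m) := fun k =>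
    congrArg Subtype.val (LinearMap.congr_fun h (φ.proj (φ.right k • m)))
  rw [← φ.sum_smul m]
  simp only [map_sum, map_smul f (φ.left _), map_smul g (φ.left _), key]

/-- Although `g` commutes only with `A`, on `eM` the element `e * b` acts as `e * b * e`, which
comes from `A`. So `g` can be moved past any `b` once `e` stands in front. -/
theorem smul_coe_map (g : φ.part M →ₗ[A] φ.part N) (b : B) (m : φ.part M) :
    (φ.e * b) • (g m).1 = (g (φ.proj (b • m.1))).1 := by
  obtain ⟨a, ha⟩ := φ.exists_apply b
  have h₁ : φ.proj (b • m.1) = a • m := Subtype.ext (by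
    rw [coe_proj, coe_smul_part, ha, mul_smul, mul_smul, φ.mem_part.1 m.2])
  rw [h₁, map_smul, coe_smul_part, ha, mul_smul _ φ.e, φ.mem_part.1 (g m).2]

/-- The extension of an `A`-linear map `eM → eN` to a `B`-linear map `M → N`. -/
def extend (g : φ.part M →ₗ[A] φ.part N) : M →ₗ[B] N where
  toFun m := ∑ k, φ.left k • (g (φ.proj (φ.right k • m))).1
  map_add' m n := by
    simp only [smul_add, proj_add, map_add, AddSubgroup.coe_add, Finset.sum_add_distrib]
  map_smul' b m := by
    -- Insert `∑ left l * e * right l = 1` to the right of `c`, then pull `e * (c * left l)` out of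
    -- `g` by `smul_coe_map`.
    have h : ∀ c : B, (g (φ.proj (c • m))).1 =
        ∑ l, (φ.e * (c * φ.left l)) • (g (φ.proj (φ.right l • m))).1 := by
      intro c
      simp_rw [φ.smul_coe_map, ← AddSubgroup.val_finsetSum, ← map_sum]
      congr 2
      apply Subtype.ext
      simp only [AddSubgroup.val_finsetSum, coe_proj, ← Finset.smul_sum, mul_smul, sum_smul]
    simp only [RingHom.id_apply, ← mul_smul b, ← mul_smul (φ.right _), Finset.smul_sum]
    simp_rw [h (φ.right _ * b), Finset.smul_sum, ← mul_smul]
    -- With the sum over `k` innermost, `∑ left k * e * right k = 1` collapses and leaves `b * left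
    -- l`.
    rw [Finset.sum_comm]
    simp_rw [← Finset.sum_smul, ← mul_assoc, ← Finset.sum_mul, φ.sum_eq, one_mul]

theorem partMap_extend (g : φ.part M →ₗ[A] φ.part N) : φ.partMap (φ.extend g) = g := by
  refine LinearMap.ext fun m => Subtype.ext ?_
  change ∑ k, φ.left k • (g (φ.proj (φ.right k • m.1))).1 = _
  simp_rw [← φ.smul_coe_map, mul_smul]
  exact φ.sum_smul _

end Obj

/-! ### Essential surjectivity through coinduced modules -/

section Coinduced

/-- The left `A`-module `eB`. -/
abbrev corow : Type u := φ.part B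

/-- Right multiplication by an element of `B` on `eB`. -/
def mulRight (b : B) : φ.corow →ₗ[A] φ.corow where
  toFun x := ⟨x.1 * b, by
    rw [mem_part, smul_eq_mul, ← mul_assoc]; exact congrArg (· * b) x.2⟩
  map_add' x y := Subtype.ext (add_mul _ _ _)
  map_smul' a x := Subtype.ext (mul_assoc (φ.toHom a) x.1 b)

@[simp] theorem coe_mulRight (b : B) (x : φ.corow) : (φ.mulRight b x).1 = x.1 * b := rfl

variable (N : Type u) [AddCommGroup N] [Module A N]

/-- Right multiplication on `eB` becomes a left action on maps out of `eB`. This coinduced module is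
the preimage of `N` under `M ↦ eM`. -/
instance : Module B (φ.corow →ₗ[A] N) where
  smul b f := f ∘ₗ φ.mulRight b
  one_smul f := LinearMap.ext fun x => congrArg f (Subtype.ext (mul_one x.1))
  mul_smul b c f := LinearMap.ext fun x => congrArg f (Subtype.ext (mul_assoc x.1 b c).symm)
  smul_zero _ := rfl
  smul_add _ _ _ := rfl
  add_smul b c f := LinearMap.ext fun x => by
    change f (φ.mulRight (b + c) x) = f (φ.mulRight b x) + f (φ.mulRight c x)
    rw [← map_add]
    exact congrArg f (Subtype.ext (mul_add x.1 b c))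
  zero_smul f := LinearMap.ext fun x => by
    change f (φ.mulRight 0 x) = 0
    rw [← map_zero f]
    exact congrArg f (Subtype.ext (mul_zero x.1))

variable {N}

theorem smul_hom_apply (b : B) (f : φ.corow →ₗ[A] N) (x : φ.corow) :
    (b • f) x = f (φ.mulRight b x) := rfl

/-- The element `e` of `eB`. -/
def unitRow : φ.corow := φ.proj 1

/-- For `x` in `eB` one has `xe = exe`, which lies in the corner and hence comes from `A`. -/
theorem exists_smul_unitRow (x : φ.corow) :
    ∃ a : A, φ.toHom a = x.1 * φ.e ∧ φ.mulRight φ.e x = a • φ.unitRow := by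
  obtain ⟨a, ha⟩ := φ.exists_apply x.1
  have hx : φ.e * x.1 = x.1 := x.2
  rw [hx] at ha
  refine ⟨a, ha, Subtype.ext ?_⟩
  simp [unitRow, ha, mul_assoc, φ.idem.eq]

/-- The element of `A` corresponding to `xe` for `x` in `eB`. -/
noncomputable def coeff (x : φ.corow) : A := (φ.exists_smul_unitRow x).choose

theorem apply_coeff (x : φ.corow) : φ.toHom (φ.coeff x) = x.1 * φ.e :=
  (φ.exists_smul_unitRow x).choose_spec.1

theorem coeff_smul_unitRow (x : φ.corow) : φ.coeff x • φ.unitRow = φ.mulRight φ.e x :=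
  (φ.exists_smul_unitRow x).choose_spec.2.symm

theorem coeff_unitRow : φ.coeff φ.unitRow = 1 := φ.injective (by
  rw [apply_coeff, map_one]; simp [unitRow, φ.idem.eq])

/-- The `A`-linear map `eB → N` that maps `e` to `n` and annihilates `eB(1 - e)`. -/
noncomputable def homOf (n : N) : φ.corow →ₗ[A] N where
  toFun x := φ.coeff x • n
  map_add' x y := by
    rw [← add_smul]
    congr 1
    apply φ.injective
    rw [map_add]
    simp only [apply_coeff]
    exact add_mul _ _ _
  map_smul' a x := by
    rw [RingHom.id_apply, ← mul_smul]
    congr 1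
    apply φ.injective
    rw [map_mul]
    simp only [apply_coeff]
    exact mul_assoc _ _ _

/-- The `A`-modules `e Hom_A(eB, N)` and `N` are isomorphic. -/
noncomputable def partHomEquiv (N : Type u) [AddCommGroup N] [Module A N] :
    φ.part (φ.corow →ₗ[A] N) ≃ₗ[A] N where
  toFun f := f.1 φ.unitRow
  map_add' _ _ := rfl
  map_smul' a f := by
    rw [RingHom.id_apply, ← map_smul, coe_smul_part, smul_hom_apply]
    congr 1
    apply Subtype.ext
    simp [unitRow, mul_apply, apply_mul]
  invFun n := ⟨φ.homOf n, by
    rw [mem_part]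
    refine LinearMap.ext fun x => ?_
    change φ.coeff (φ.mulRight φ.e x) • n = φ.coeff x • n
    congr 1
    apply φ.injective
    rw [apply_coeff, apply_coeff, coe_mulRight, mul_assoc, φ.idem.eq]⟩
  left_inv f := by
    refine Subtype.ext (LinearMap.ext fun x => ?_)
    change φ.coeff x • f.1 φ.unitRow = f.1 x
    -- Being fixed by `e` means `f x = f (x e)`, and `x e` is an `A`-multiple of `e`; so `f` is
    -- determined by its value at `e`.
    rw [← map_smul, coeff_smul_unitRow, ← smul_hom_apply, φ.mem_part.1 f.2]
  right_inv n := by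
    change φ.coeff φ.unitRow • n = n
    rw [coeff_unitRow, one_smul]

end Coinduced

/-- The functor that maps a `B`-module `M` to the `A`-module `eM`. -/
def functor : ModuleCat.{u} B ⥤ ModuleCat.{u} A where
  obj M := ModuleCat.of A (φ.part M)
  map f := ModuleCat.ofHom (φ.partMap f.hom)

instance : φ.functor.Faithful where
  map_injective {_ _} _ _ h := ModuleCat.hom_ext (φ.partMap_injective (ModuleCat.hom_ext_iff.1 h))

instance : φ.functor.Full where
  map_surjective g :=
    ⟨ModuleCat.ofHom (φ.extend g.hom), ModuleCat.hom_ext (φ.partMap_extend g.hom)⟩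

instance : φ.functor.EssSurj where
  mem_essImage N :=
    ⟨ModuleCat.of B (φ.corow →ₗ[A] N), ⟨(φ.partHomEquiv N).toModuleIso⟩⟩

instance : φ.functor.IsEquivalence where

open scoped ModuleCat.Algebra

theorem algebraMap_apply (k : K) : φ.toHom (algebraMap K A k) = k • φ.e := by
  rw [Algebra.algebraMap_eq_smul_one, map_smul, map_one]

/-- A scalar `k` acts on an `A`-module through the image of `k` in `A`, which goes to `k • e` in
`B`; on `eM` this agrees with the action of `k` because `e` acts as the identity. -/
instance : φ.functor.Linear K where
  map_smul {M N} f k := ModuleCat.hom_ext (LinearMap.ext fun m => Subtype.ext (by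
    change algebraMap K B k • f.hom m.1 = φ.toHom (algebraMap K A k) • f.hom m.1
    rw [algebraMap_apply, ← mul_one (algebraMap K B k), ← map_smul, ← map_smul]
    congr 1
    rw [mul_one, ← φ.mem_part.1 m.2, ← mul_smul, ← mul_smul, ← Algebra.smul_def, smul_mul_assoc,
      φ.idem.eq]))

include φ in
/-- An algebra is Morita equivalent to each of its full corners. -/
theorem isMoritaEquivalent : IsMoritaEquivalent K A B :=
  -- The functor leads from `B`-modules to `A`-modules, whence the symmetry.
  IsMoritaEquivalent.symm K ⟨⟨⟨φ.functor.asEquivalence, inferInstanceAs (φ.functor.Linear K)⟩⟩⟩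

end FullCornerHom

end FullCorner

/-! ### Matrices with a single entry -/

namespace Matrix

variable {m n A : Type*} [DecidableEq m] [DecidableEq n]

theorem single_ite_zero [Zero A] (P : Prop) [Decidable P] (p : m) (q : n) (a : A) :
    single p q (if P then a else 0) = if P then single p q a else 0 := by
  split_ifs <;> simp

theorem sum_single_apply {ι : Type*} [AddCommMonoid A] (s : Finset ι) (p : m) (q : n)
    (f : ι → A) : ∑ i ∈ s, single p q (f i) = single p q (∑ i ∈ s, f i) :=
  (map_sum (singleAddMonoidHom p q : A →+ Matrix m n A) f s).symm

end Matrix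

/-! ### Lonely vertex elimination for Leavitt path algebras -/

namespace MultIndex

variable {V : Type*} {m : V → ℕ}

theorem mult_ne_zero (i : MultIndex m) : m i.elt ≠ 0 := (Fin.pos i.occ).ne'

theorem elt_ne {v : V} (hm : m v = 0) (i : MultIndex m) : i.elt ≠ v :=
  fun e => i.mult_ne_zero (e ▸ hm)

/-- The occurrences of elements in a multiset that does not contain `v`. -/
def restrict {v : V} (hm : m v = 0) :
    MultIndex m ≃ MultIndex (fun u : {u : V // u ≠ v} => m u.1) where
  toFun i := ⟨⟨i.elt, i.elt_ne hm⟩, i.occ⟩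
  invFun i := ⟨i.elt.1, i.occ⟩
  left_inv _ := rfl
  right_inv _ := rfl

end MultIndex

namespace OrientedHypergraph

variable {V E : Type*}

/-- `v` is a lonely vertex, and `h` is the hyperedge with `s(h) = {v}`. -/
structure IsLonely (H : OrientedHypergraph V E) (v : V) (h : E) : Prop where
  source_self : H.s h v = 1
  source_ne : ∀ u, u ≠ v → H.s h u = 0
  not_range : H.r h v = 0
  other : ∀ g, g ≠ h → H.s g v = 0 ∧ H.r g v = 0

/-- The hypergraph obtained by removing a lonely vertex and the corresponding hyperedge. -/
def eliminate (H : OrientedHypergraph V E) {v : V} {h : E} (hv : H.IsLonely v h) :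
    OrientedHypergraph {u : V // u ≠ v} {g : E // g ≠ h} where
  s g u := H.s g.1 u.1
  r g u := H.r g.1 u.1
  s_nonempty g := by
    obtain ⟨u, hu⟩ := H.s_nonempty g.1
    exact ⟨⟨u, fun e => hu (e ▸ (hv.other g.1 g.2).1)⟩, hu⟩
  r_nonempty g := by
    obtain ⟨u, hu⟩ := H.r_nonempty g.1
    exact ⟨⟨u, fun e => hu (e ▸ (hv.other g.1 g.2).2)⟩, hu⟩

variable {H : OrientedHypergraph V E} {v : V} {h : E} (hv : H.IsLonely v h)

namespace IsLonely

/-- The only source of the hyperedge of a lonely vertex. -/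
def source : MultIndex (H.s h) := ⟨v, ⟨0, by rw [hv.source_self]; exact one_pos⟩⟩

@[simp] theorem source_elt : hv.source.elt = v := rfl

include hv in
theorem source_elt_eq (i : MultIndex (H.s h)) : i.elt = v := by
  by_contra hne
  exact i.mult_ne_zero (hv.source_ne _ hne)

include hv in
theorem eq_source (i : MultIndex (H.s h)) : i = hv.source := by
  obtain ⟨u, k⟩ := i
  obtain rfl : u = v := hv.source_elt_eq ⟨u, k⟩
  have hk : k = ⟨0, by rw [hv.source_self]; exact one_pos⟩ := by
    apply Fin.ext
    have := k.2.trans_eq hv.source_self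
    exact Nat.lt_one_iff.1 this
  rw [hk]; rfl

theorem sum_source {A : Type*} [Finite V] [AddCommMonoid A] (f : MultIndex (H.s h) → A) :
    ∑ i, f i = f hv.source :=
  Finset.sum_eq_single _ (fun i _ hi => absurd (hv.eq_source i) hi)
    fun hn => absurd (Finset.mem_univ _) hn

/-- The sources of a hyperedge that remains after eliminating a lonely vertex. -/
def sourceEquiv (g : {g : E // g ≠ h}) :
    MultIndex (H.s g.1) ≃ MultIndex ((H.eliminate hv).s g) :=
  MultIndex.restrict (hv.other g.1 g.2).1

/-- The ranges of a hyperedge that remains after eliminating a lonely vertex. -/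
def rangeEquiv (g : {g : E // g ≠ h}) :
    MultIndex (H.r g.1) ≃ MultIndex ((H.eliminate hv).r g) :=
  MultIndex.restrict (hv.other g.1 g.2).2

@[simp] theorem sourceEquiv_symm_elt (g : {g : E // g ≠ h})
    (i : MultIndex ((H.eliminate hv).s g)) : ((hv.sourceEquiv g).symm i).elt = i.elt.1 := rfl

@[simp] theorem rangeEquiv_symm_elt (g : {g : E // g ≠ h})
    (j : MultIndex ((H.eliminate hv).r g)) : ((hv.rangeEquiv g).symm j).elt = j.elt.1 := rfl

end IsLonely

namespace LeavittFamily

variable [Finite V]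

open Classical in
/-- The restriction of a Leavitt family to the hypergraph obtained by eliminating a lonely
vertex. -/
noncomputable def restrict {A : Type*} [NonUnitalSemiring A] (F : LeavittFamily H A) :
    LeavittFamily (H.eliminate hv) A where
  vert u := F.vert u.1
  edge g i j := F.edge g.1 ((hv.sourceEquiv g).symm i) ((hv.rangeEquiv g).symm j)
  ghost g i j := F.ghost g.1 ((hv.sourceEquiv g).symm i) ((hv.rangeEquiv g).symm j)
  vert_mul u w := by simpa only [Subtype.ext_iff] using F.vert_mul u.1 w.1
  vert_edge g i j := F.vert_edge g.1 ((hv.sourceEquiv g).symm i) ((hv.rangeEquiv g).symm j)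
  edge_vert g i j := F.edge_vert g.1 ((hv.sourceEquiv g).symm i) ((hv.rangeEquiv g).symm j)
  vert_ghost g i j := F.vert_ghost g.1 ((hv.sourceEquiv g).symm i) ((hv.rangeEquiv g).symm j)
  ghost_vert g i j := F.ghost_vert g.1 ((hv.sourceEquiv g).symm i) ((hv.rangeEquiv g).symm j)
  edge_ghost g i i' := by
    rw [Equiv.sum_comp (hv.rangeEquiv g).symm fun j =>
      F.edge g.1 ((hv.sourceEquiv g).symm i) j * F.ghost g.1 ((hv.sourceEquiv g).symm i') j,
      F.edge_ghost]
    simp only [EmbeddingLike.apply_eq_iff_eq, IsLonely.sourceEquiv_symm_elt]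
  ghost_edge g j j' := by
    rw [Equiv.sum_comp (hv.sourceEquiv g).symm fun i =>
      F.ghost g.1 i ((hv.rangeEquiv g).symm j) * F.edge g.1 i ((hv.rangeEquiv g).symm j'),
      F.ghost_edge]
    simp only [EmbeddingLike.apply_eq_iff_eq, IsLonely.rangeEquiv_symm_elt]

/-! ### Matrices over the small algebra realising the large hypergraph -/

section Extend

open Matrix

variable {A : Type*} [NonUnitalSemiring A] (F : LeavittFamily (H.eliminate hv) A)

/-- The vertex of the smaller hypergraph given by a range of the hyperedge of a lonely vertex. -/
def rangeVertex (j : MultIndex (H.r h)) : {u : V // u ≠ v} := ⟨j.elt, j.elt_ne hv.not_range⟩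

open Classical in
/-- The idempotent matrix attached to a vertex. -/
noncomputable def extendVert (u : V) :
    Matrix (Option (MultIndex (H.r h))) (Option (MultIndex (H.r h))) A :=
  -- Each occurrence of a range of `h` gets its own diagonal slot, so that `v` is by construction
  -- the direct sum of these ranges and `h` can be realised by matrix units cut down by them.
  if hu : u = v then ∑ j, single (some j) (some j) (F.vert (rangeVertex hv j))
  else single none none (F.vert ⟨u, hu⟩)

open Classical in
/-- The matrix attached to a generator `h_{ij}`. -/
noncomputable def extendEdge (g : E) (i : MultIndex (H.s g)) (j : MultIndex (H.r g)) :
    Matrix (Option (MultIndex (H.r h))) (Option (MultIndex (H.r h))) A :=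
  if hg : g = h then single (some (hg ▸ j)) none (F.vert (rangeVertex hv (hg ▸ j)))
  else single none none (F.edge ⟨g, hg⟩ (hv.sourceEquiv ⟨g, hg⟩ i) (hv.rangeEquiv ⟨g, hg⟩ j))

open Classical in
/-- The matrix attached to a generator `h_{ij}^*`. -/
noncomputable def extendGhost (g : E) (i : MultIndex (H.s g)) (j : MultIndex (H.r g)) :
    Matrix (Option (MultIndex (H.r h))) (Option (MultIndex (H.r h))) A :=
  if hg : g = h then single none (some (hg ▸ j)) (F.vert (rangeVertex hv (hg ▸ j)))
  else single none none (F.ghost ⟨g, hg⟩ (hv.sourceEquiv ⟨g, hg⟩ i) (hv.rangeEquiv ⟨g, hg⟩ j))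

open Classical in
theorem extendVert_self :
    extendVert hv F v = ∑ j, single (some j) (some j) (F.vert (rangeVertex hv j)) :=
  dif_pos rfl

open Classical in
theorem extendVert_of_ne {u : V} (hu : u ≠ v) :
    extendVert hv F u = single none none (F.vert ⟨u, hu⟩) :=
  dif_neg hu

open Classical in
theorem extendEdge_self (i : MultIndex (H.s h)) (j : MultIndex (H.r h)) :
    extendEdge hv F h i j = single (some j) none (F.vert (rangeVertex hv j)) :=
  dif_pos rfl

open Classical in
theorem extendEdge_of_ne {g : E} (hg : g ≠ h) (i : MultIndex (H.s g)) (j : MultIndex (H.r g)) :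
    extendEdge hv F g i j =
      single none none
        (F.edge ⟨g, hg⟩ (hv.sourceEquiv ⟨g, hg⟩ i) (hv.rangeEquiv ⟨g, hg⟩ j)) :=
  dif_neg hg

open Classical in
theorem extendGhost_self (i : MultIndex (H.s h)) (j : MultIndex (H.r h)) :
    extendGhost hv F h i j = single none (some j) (F.vert (rangeVertex hv j)) :=
  dif_pos rfl

open Classical in
theorem extendGhost_of_ne {g : E} (hg : g ≠ h) (i : MultIndex (H.s g)) (j : MultIndex (H.r g)) :
    extendGhost hv F g i j =
      single none none
        (F.ghost ⟨g, hg⟩ (hv.sourceEquiv ⟨g, hg⟩ i) (hv.rangeEquiv ⟨g, hg⟩ j)) :=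
  dif_neg hg

open Classical in
theorem extendVert_self_mul_single (j : MultIndex (H.r h)) (q : Option (MultIndex (H.r h))) :
    extendVert hv F v * single (some j) q (F.vert (rangeVertex hv j)) =
      single (some j) q (F.vert (rangeVertex hv j)) := by
  rw [extendVert_self, Finset.sum_mul, Finset.sum_eq_single j]
  · rw [single_mul_single_same, F.vert_self]
  · intro k _ hk
    rw [single_mul_single_of_ne _ _ _ _ (by simpa using hk)]
  · simp

open Classical in
theorem single_mul_extendVert_self (j : MultIndex (H.r h)) (q : Option (MultIndex (H.r h))) :
    single q (some j) (F.vert (rangeVertex hv j)) * extendVert hv F v =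
      single q (some j) (F.vert (rangeVertex hv j)) := by
  rw [extendVert_self, Finset.mul_sum, Finset.sum_eq_single j]
  · rw [single_mul_single_same, F.vert_self]
  · intro k _ hk
    rw [single_mul_single_of_ne _ _ _ _ (by simpa using hk.symm)]
  · simp

open Classical in
/-- The extension of a Leavitt family of the hypergraph obtained by eliminating a lonely vertex
to a Leavitt family of matrices of the original hypergraph. -/
noncomputable def extend :
    LeavittFamily H (Matrix (Option (MultIndex (H.r h))) (Option (MultIndex (H.r h))) A) where
  vert := extendVert hv F
  edge := extendEdge hv F
  ghost := extendGhost hv F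
  vert_mul u w := by
    by_cases hu : u = v <;> by_cases hw : w = v
    · rw [hu, hw, if_pos rfl]
      conv_lhs => enter [2]; rw [extendVert_self]
      simp_rw [Finset.mul_sum, extendVert_self_mul_single]
      rw [extendVert_self]
    · rw [if_neg (hu ▸ Ne.symm hw), hu, extendVert_self, extendVert_of_ne hv F hw,
        Finset.sum_mul]
      exact Finset.sum_eq_zero fun j _ => single_mul_single_of_ne _ _ _ _ (by simp) _
    · rw [if_neg (hw ▸ hu), hw, extendVert_self, extendVert_of_ne hv F hu, Finset.mul_sum]
      exact Finset.sum_eq_zero fun j _ => single_mul_single_of_ne _ _ _ _ (by simp) _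
    · rw [extendVert_of_ne hv F hu, extendVert_of_ne hv F hw, single_mul_single_same, F.vert_mul,
        single_ite_zero]
      simp only [Subtype.mk.injEq]
  vert_edge g i j := by
    by_cases hg : g = h
    · subst hg
      rw [extendEdge_self, hv.source_elt_eq i, extendVert_self_mul_single]
    · rw [extendEdge_of_ne hv F hg, extendVert_of_ne hv F (i.elt_ne (hv.other g hg).1),
        single_mul_single_same]
      exact congrArg _ (F.vert_edge ⟨g, hg⟩ (hv.sourceEquiv ⟨g, hg⟩ i) _)
  edge_vert g i j := by
    by_cases hg : g = h
    · subst hg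
      rw [extendEdge_self, extendVert_of_ne hv F (j.elt_ne hv.not_range), single_mul_single_same]
      exact congrArg _ (F.vert_self _)
    · rw [extendEdge_of_ne hv F hg, extendVert_of_ne hv F (j.elt_ne (hv.other g hg).2),
        single_mul_single_same]
      exact congrArg _ (F.edge_vert ⟨g, hg⟩ _ (hv.rangeEquiv ⟨g, hg⟩ j))
  vert_ghost g i j := by
    by_cases hg : g = h
    · subst hg
      rw [extendGhost_self, extendVert_of_ne hv F (j.elt_ne hv.not_range), single_mul_single_same]
      exact congrArg _ (F.vert_self _)
    · rw [extendGhost_of_ne hv F hg, extendVert_of_ne hv F (j.elt_ne (hv.other g hg).2),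
        single_mul_single_same]
      exact congrArg _ (F.vert_ghost ⟨g, hg⟩ _ (hv.rangeEquiv ⟨g, hg⟩ j))
  ghost_vert g i j := by
    by_cases hg : g = h
    · subst hg
      rw [extendGhost_self, hv.source_elt_eq i, single_mul_extendVert_self]
    · rw [extendGhost_of_ne hv F hg, extendVert_of_ne hv F (i.elt_ne (hv.other g hg).1),
        single_mul_single_same]
      exact congrArg _ (F.ghost_vert ⟨g, hg⟩ (hv.sourceEquiv ⟨g, hg⟩ i) _)
  edge_ghost g i i' := by
    by_cases hg : g = h
    · subst hg
      -- There is only one source, so the Kronecker delta is `1`, and the sum over `j` is the matrix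
      -- chosen for `v`.
      rw [if_pos ((hv.eq_source i).trans (hv.eq_source i').symm), hv.source_elt_eq i,
        extendVert_self]
      refine Finset.sum_congr rfl fun j _ => ?_
      rw [extendEdge_self, extendGhost_self, single_mul_single_same, F.vert_self]
    · simp_rw [extendEdge_of_ne hv F hg, extendGhost_of_ne hv F hg, single_mul_single_same]
      rw [sum_single_apply, extendVert_of_ne hv F (i.elt_ne (hv.other g hg).1)]
      rw [Equiv.sum_comp (hv.rangeEquiv ⟨g, hg⟩) fun j => F.edge ⟨g, hg⟩ _ j * F.ghost ⟨g, hg⟩ _ j,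
        F.edge_ghost]
      simp only [EmbeddingLike.apply_eq_iff_eq]
      exact single_ite_zero _ _ _ _
  ghost_edge g j j' := by
    by_cases hg : g = h
    · subst hg
      rw [hv.sum_source, extendGhost_self, extendEdge_self]
      split_ifs with hj
      · rw [hj, extendVert_of_ne hv F (j'.elt_ne hv.not_range), single_mul_single_same]
        exact congrArg _ (F.vert_self _)
      · exact single_mul_single_of_ne _ _ _ _ (by simpa using hj) _
    · simp_rw [extendEdge_of_ne hv F hg, extendGhost_of_ne hv F hg, single_mul_single_same]
      rw [sum_single_apply, extendVert_of_ne hv F (j.elt_ne (hv.other g hg).2)]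
      rw [Equiv.sum_comp (hv.sourceEquiv ⟨g, hg⟩) fun i => F.ghost ⟨g, hg⟩ i _ * F.edge ⟨g, hg⟩ i _,
        F.ghost_edge]
      simp only [EmbeddingLike.apply_eq_iff_eq]
      exact single_ite_zero _ _ _ _

end Extend

end LeavittFamily

/-! ### The corner homomorphism, fullness, and the range -/

namespace IsLonely

variable [Finite V] (K : Type*) [Field K]

/-- The homomorphism from the Leavitt path algebra of the hypergraph obtained by eliminating a
lonely vertex to the one of the original hypergraph. -/
noncomputable def cornerHom :
    LeavittPathAlgebra K (H.eliminate hv) →ₙₐ[K] LeavittPathAlgebra K H :=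
  ((H.leavittFamily K).restrict hv).lift K

/-- The generators of the smaller hypergraph add up to `e` rather than `1` in the larger algebra, so
the universal property yields a map onto a subalgebra with unit `e`. -/
theorem unit_restrict : ((H.leavittFamily K).restrict hv).unit = H.coVertL K v := rfl

open Classical in
-- This composite has an evident left inverse, reading off the entry at `(none, none)`, and so
-- forces `cornerHom` to be injective.
theorem lift_extend_cornerHom (a : LeavittPathAlgebra K (H.eliminate hv)) :
    (((H.eliminate hv).leavittFamily K).extend hv).lift K (hv.cornerHom K a) =
      Matrix.single none none a := by
  induction a using leavitt_induction with
  | vert u =>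
    rw [cornerHom, lift_vert, LeavittFamily.restrict, lift_vert]
    exact LeavittFamily.extendVert_of_ne hv _ u.2
  | edge g i j =>
    rw [cornerHom, lift_edge, LeavittFamily.restrict, lift_edge]
    exact LeavittFamily.extendEdge_of_ne hv _ g.2 _ _
  | ghost g i j =>
    rw [cornerHom, lift_ghost, LeavittFamily.restrict, lift_ghost]
    exact LeavittFamily.extendGhost_of_ne hv _ g.2 _ _
  | zero => rw [map_zero, map_zero, Matrix.single_zero]
  | add a b ha hb => rw [map_add, map_add, ha, hb, Matrix.single_add]
  | mul a b ha hb => rw [map_mul, map_mul, ha, hb, Matrix.single_mul_single_same]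
  | smul k a ha => rw [map_smul, map_smul, ha, Matrix.smul_single]

theorem cornerHom_injective : Function.Injective (hv.cornerHom K) := by
  classical
  intro a b hab
  have := congrArg ((((H.eliminate hv).leavittFamily K).extend hv).lift K) hab
  rw [lift_extend_cornerHom, lift_extend_cornerHom] at this
  simpa using congrFun (congrFun this none) none

/-- The idempotent `e` and the generators `h_{ij}` for the hyperedge `h` of a lonely vertex. -/
noncomputable def row : Option (MultIndex (H.r h)) → LeavittPathAlgebra K H
  | none => H.coVertL K v
  | some j => (H.leavittFamily K).edge h hv.source j

/-- The idempotent `e` and the generators `h_{ij}^*` for the hyperedge `h` of a lonely vertex. -/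
noncomputable def col : Option (MultIndex (H.r h)) → LeavittPathAlgebra K H
  | none => H.coVertL K v
  | some j => (H.leavittFamily K).ghost h hv.source j

include hv in
theorem isIdempotentElem_coVertL : IsIdempotentElem (H.coVertL K v) :=
  ((H.leavittFamily K).restrict hv).isIdempotentElem_unit

include hv in
theorem coVertL_mul_vert {u : V} (hu : u ≠ v) :
    H.coVertL K v * (H.leavittFamily K).vert u = (H.leavittFamily K).vert u :=
  ((H.leavittFamily K).restrict hv).unit_mul_vert ⟨u, hu⟩

include hv in
theorem vert_mul_coVertL {u : V} (hu : u ≠ v) :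
    (H.leavittFamily K).vert u * H.coVertL K v = (H.leavittFamily K).vert u :=
  ((H.leavittFamily K).restrict hv).vert_mul_unit ⟨u, hu⟩

theorem coVertL_add_vert : H.coVertL K v + (H.leavittFamily K).vert v = 1 := by
  classical
  have := Fintype.ofFinite V
  rw [← sum_vert_leavittFamily, ← Finset.sum_erase_add _ _ (Finset.mem_univ v), coVertL,
    finsum_eq_sum_of_fintype]
  congr 1
  exact (Finset.sum_subtype (Finset.univ.erase v) (by simp) (vertL K H)).symm

include hv in
theorem coVertL_mul_vert_self : H.coVertL K v * (H.leavittFamily K).vert v = 0 := by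
  have h := congrArg (H.coVertL K v * ·) (coVertL_add_vert (H := H) (v := v) K)
  simpa [mul_add, (hv.isIdempotentElem_coVertL K).eq] using h

include hv in
theorem vert_self_mul_coVertL : (H.leavittFamily K).vert v * H.coVertL K v = 0 := by
  have h := congrArg (· * H.coVertL K v) (coVertL_add_vert (H := H) (v := v) K)
  simpa [add_mul, (hv.isIdempotentElem_coVertL K).eq] using h

theorem coVertL_mul_edge (j : MultIndex (H.r h)) :
    H.coVertL K v * (H.leavittFamily K).edge h hv.source j = 0 := by
  rw [← (H.leavittFamily K).vert_edge, ← mul_assoc, source_elt, hv.coVertL_mul_vert_self K,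
    zero_mul]

theorem edge_mul_coVertL (j : MultIndex (H.r h)) :
    (H.leavittFamily K).edge h hv.source j * H.coVertL K v =
      (H.leavittFamily K).edge h hv.source j := by
  rw [← (H.leavittFamily K).edge_vert, mul_assoc,
    hv.vert_mul_coVertL K (j.elt_ne hv.not_range)]

theorem ghost_mul_coVertL (j : MultIndex (H.r h)) :
    (H.leavittFamily K).ghost h hv.source j * H.coVertL K v = 0 := by
  rw [← (H.leavittFamily K).ghost_vert, mul_assoc, source_elt, hv.vert_self_mul_coVertL K,
    mul_zero]

theorem coVertL_mul_ghost (j : MultIndex (H.r h)) :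
    H.coVertL K v * (H.leavittFamily K).ghost h hv.source j =
      (H.leavittFamily K).ghost h hv.source j := by
  rw [← (H.leavittFamily K).vert_ghost, ← mul_assoc,
    hv.coVertL_mul_vert K (j.elt_ne hv.not_range)]

/-- The terms `h_j h_j^*` add up to `v`, and the `none` term is `e = 1 - v`. -/
theorem sum_row_mul_col : ∑ p, hv.row K p * hv.col K p = 1 := by
  rw [Fintype.sum_option, ← coVertL_add_vert (H := H) (v := v) K]
  simp only [row, col]
  rw [(hv.isIdempotentElem_coVertL K).eq, (H.leavittFamily K).edge_ghost, if_pos rfl, source_elt]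

/-- As `v` is not a range of `h`, each `h_j` absorbs `e` on the right; so `e` may be inserted in the
preceding decomposition of `1`, which makes it full. -/
theorem sum_row_mul_coVertL_mul_col :
    ∑ p, hv.row K p * H.coVertL K v * hv.col K p = 1 := by
  rw [← hv.sum_row_mul_col K]
  refine Finset.sum_congr rfl fun p _ => ?_
  cases p with
  | none => simp only [row, col, (hv.isIdempotentElem_coVertL K).eq]
  | some j => simp only [row, col, edge_mul_coVertL]

include hv in
theorem span_coVertL : TwoSidedIdeal.span {H.coVertL K v} = ⊤ := by
  rw [← TwoSidedIdeal.one_mem_iff, ← hv.sum_row_mul_coVertL_mul_col K]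
  refine sum_mem fun p _ => TwoSidedIdeal.mul_mem_right _ _ _ (TwoSidedIdeal.mul_mem_left _ _ _ ?_)
  exact TwoSidedIdeal.subset_span rfl

theorem vert_mem_range {u : V} (hu : u ≠ v) :
    (H.leavittFamily K).vert u ∈ Set.range (hv.cornerHom K) :=
  ⟨((H.eliminate hv).leavittFamily K).vert ⟨u, hu⟩, lift_vert ..⟩

theorem edge_mem_range {g : E} (hg : g ≠ h) (i : MultIndex (H.s g)) (j : MultIndex (H.r g)) :
    (H.leavittFamily K).edge g i j ∈ Set.range (hv.cornerHom K) :=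
  ⟨((H.eliminate hv).leavittFamily K).edge ⟨g, hg⟩ (hv.sourceEquiv ⟨g, hg⟩ i)
    (hv.rangeEquiv ⟨g, hg⟩ j), lift_edge ..⟩

theorem ghost_mem_range {g : E} (hg : g ≠ h) (i : MultIndex (H.s g)) (j : MultIndex (H.r g)) :
    (H.leavittFamily K).ghost g i j ∈ Set.range (hv.cornerHom K) :=
  ⟨((H.eliminate hv).leavittFamily K).ghost ⟨g, hg⟩ (hv.sourceEquiv ⟨g, hg⟩ i)
    (hv.rangeEquiv ⟨g, hg⟩ j), lift_ghost ..⟩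

theorem cornerHom_one : hv.cornerHom K 1 = H.coVertL K v := by
  have := Fintype.ofFinite V
  classical
  rw [← sum_vert_leavittFamily, map_sum, ← hv.unit_restrict, LeavittFamily.unit,
    finsum_eq_sum_of_fintype]
  exact Finset.sum_congr rfl fun u _ => lift_vert ..

theorem coVertL_mul_cornerHom_mul (a : LeavittPathAlgebra K (H.eliminate hv)) :
    H.coVertL K v * hv.cornerHom K a * H.coVertL K v = hv.cornerHom K a := by
  rw [← hv.cornerHom_one, ← map_mul, ← map_mul, one_mul, mul_one]

theorem zero_mem_range : 0 ∈ Set.range (hv.cornerHom K) := ⟨0, map_zero _⟩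

/-- Here `b = e b e`, while `h_j^* e = 0` and `e h_j = 0`; only `p = q = none` survives, and there
the product is `b` itself. -/
theorem col_mul_mul_row_mem_of_mem {b : LeavittPathAlgebra K H}
    (hb : b ∈ Set.range (hv.cornerHom K)) (p q : Option (MultIndex (H.r h))) :
    hv.col K p * b * hv.row K q ∈ Set.range (hv.cornerHom K) := by
  obtain ⟨a, rfl⟩ := hb
  rw [← coVertL_mul_cornerHom_mul]
  cases p with
  | some j =>
    simp only [col, ← mul_assoc, ghost_mul_coVertL, zero_mul]
    exact hv.zero_mem_range K
  | none =>
    cases q with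
    | some j =>
      simp only [row, mul_assoc, coVertL_mul_edge, mul_zero]
      exact hv.zero_mem_range K
    | none =>
      simp only [row, col]
      rw [coVertL_mul_cornerHom_mul, coVertL_mul_cornerHom_mul]
      exact ⟨a, rfl⟩

/-- Since `h` has a single source, this product is the entire sum in a defining relation, hence a
vertex other than `v` or zero. -/
theorem ghost_mul_edge_mem_range (j j' : MultIndex (H.r h)) :
    (H.leavittFamily K).ghost h hv.source j * (H.leavittFamily K).edge h hv.source j' ∈
      Set.range (hv.cornerHom K) := by
  classical
  rw [← hv.sum_source fun i => (H.leavittFamily K).ghost h i j * (H.leavittFamily K).edge h i j',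
    (H.leavittFamily K).ghost_edge]
  split_ifs
  · exact hv.vert_mem_range K (j.elt_ne hv.not_range)
  · exact hv.zero_mem_range K

theorem mul_mem_range {a b : LeavittPathAlgebra K H} (ha : a ∈ Set.range (hv.cornerHom K))
    (hb : b ∈ Set.range (hv.cornerHom K)) : a * b ∈ Set.range (hv.cornerHom K) := by
  obtain ⟨a, rfl⟩ := ha
  obtain ⟨b, rfl⟩ := hb
  exact ⟨a * b, map_mul ..⟩

theorem add_mem_range {a b : LeavittPathAlgebra K H} (ha : a ∈ Set.range (hv.cornerHom K))
    (hb : b ∈ Set.range (hv.cornerHom K)) : a + b ∈ Set.range (hv.cornerHom K) := by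
  obtain ⟨a, rfl⟩ := ha
  obtain ⟨b, rfl⟩ := hb
  exact ⟨a + b, map_add ..⟩

/-- The product `col p * row q`. -/
theorem col_mul_row_mem (p q : Option (MultIndex (H.r h))) :
    hv.col K p * hv.row K q ∈ Set.range (hv.cornerHom K) := by
  cases p with
  | some j =>
    cases q with
    | some j' => exact hv.ghost_mul_edge_mem_range K j j'
    | none => rw [row, col, ghost_mul_coVertL]; exact hv.zero_mem_range K
  | none =>
    cases q with
    | some j' => rw [row, col, coVertL_mul_edge]; exact hv.zero_mem_range K
    | none =>
      rw [row, col, (hv.isIdempotentElem_coVertL K).eq]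
      exact ⟨1, hv.cornerHom_one K⟩

/-- Surjectivity onto the corner is the case `p = q = none`; the other indices are carried along
because products of generators may pass through `v`. -/
theorem col_mul_mul_row_mem (b : LeavittPathAlgebra K H) (p q : Option (MultIndex (H.r h))) :
    hv.col K p * b * hv.row K q ∈ Set.range (hv.cornerHom K) := by
  classical
  induction b using leavitt_induction generalizing p q with
  | vert u =>
    by_cases hu : u = v
    · subst hu
      -- Use `v = 1 - e`, where `e` lies in the range as the image of `1`.
      rw [eq_sub_of_add_eq' (coVertL_add_vert (H := H) (v := u) K), mul_sub, sub_mul, mul_one,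
        sub_eq_add_neg]
      refine hv.add_mem_range K (hv.col_mul_row_mem K p q) ?_
      obtain ⟨a, ha⟩ := hv.col_mul_mul_row_mem_of_mem K ⟨1, hv.cornerHom_one K⟩ p q
      exact ⟨-a, by rw [map_neg, ha]⟩
    · exact hv.col_mul_mul_row_mem_of_mem K (hv.vert_mem_range K hu) p q
  | edge g i j =>
    by_cases hg : g = h
    · subst hg
      -- Factor `h_j = h_j e` as `row (some j) * col none`.
      rw [hv.eq_source i, ← edge_mul_coVertL, mul_assoc, mul_assoc, ← mul_assoc]
      exact hv.mul_mem_range K (hv.col_mul_row_mem K p (some j)) (hv.col_mul_row_mem K none q)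
    · exact hv.col_mul_mul_row_mem_of_mem K (hv.edge_mem_range K hg i j) p q
  | ghost g i j =>
    by_cases hg : g = h
    · subst hg
      -- Factor `h_j^* = e h_j^*` as `row none * col (some j)`.
      rw [hv.eq_source i, ← coVertL_mul_ghost, ← mul_assoc, mul_assoc]
      exact hv.mul_mem_range K (hv.col_mul_row_mem K p none) (hv.col_mul_row_mem K (some j) q)
    · exact hv.col_mul_mul_row_mem_of_mem K (hv.ghost_mem_range K hg i j) p q
  | zero => rw [mul_zero, zero_mul]; exact hv.zero_mem_range K
  | add a b ha hb => rw [mul_add, add_mul]; exact hv.add_mem_range K (ha p q) (hb p q)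
  | mul a b ha hb =>
    -- Inserting `∑ row r * col r` between `a` and `b` splits the product into terms covered by both
    -- induction hypotheses.
    rw [← mul_one a, ← hv.sum_row_mul_col K, Finset.mul_sum, Finset.sum_mul, Finset.mul_sum,
      Finset.sum_mul]
    refine Finset.sum_induction _ (· ∈ Set.range (hv.cornerHom K))
      (fun _ _ => hv.add_mem_range K) (hv.zero_mem_range K) fun r _ => ?_
    have := hv.mul_mem_range K (ha p r) (hb r q)
    simpa only [mul_assoc] using this
  | smul k a ha =>
    obtain ⟨c, hc⟩ := ha p q
    exact ⟨k • c, by rw [map_smul, hc, mul_smul_comm, smul_mul_assoc]⟩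

theorem range_cornerHom :
    Set.range (hv.cornerHom K) = {x | ∃ a, x = H.coVertL K v * a * H.coVertL K v} := by
  ext x
  constructor
  · rintro ⟨a, rfl⟩
    exact ⟨hv.cornerHom K a, (hv.coVertL_mul_cornerHom_mul K a).symm⟩
  · rintro ⟨a, rfl⟩
    exact hv.col_mul_mul_row_mem K a none none

end IsLonely

end OrientedHypergraph

namespace OrientedHypergraph.IsLonely

universe w u v

variable {V : Type u} {E : Type v} [Finite V] {H : OrientedHypergraph V E} {v : V} {h : E}

/-- The Leavitt path algebra of the hypergraph obtained by eliminating a lonely vertex as a full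
corner. -/
noncomputable def fullCornerHom (hv : H.IsLonely v h) (K : Type w) [Field K] :
    FullCornerHom K (LeavittPathAlgebra K (H.eliminate hv)) (LeavittPathAlgebra K H) where
  toHom := hv.cornerHom K
  e := H.coVertL K v
  idem := hv.isIdempotentElem_coVertL K
  injective := hv.cornerHom_injective K
  range_eq := hv.range_cornerHom K
  ι := Option (MultIndex (H.r h))
  left := hv.row K
  right := hv.col K
  sum_eq := hv.sum_row_mul_coVertL_mul_col K

end OrientedHypergraph.IsLonely

/-! ### Bergman algebras of basic presentations as Leavitt path algebras -/

namespace BergmanPresentation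

variable {X I : Type*}

/-- The hypergraph corresponding to a Bergman presentation. -/
abbrev hypergraph (P : BergmanPresentation X I) : OrientedHypergraph X I where
  s i x := P.a i x
  r i x := P.b i x
  s_nonempty i := by
    by_contra! h
    exact P.a_ne_zero i (Finsupp.ext h)
  r_nonempty i := by
    by_contra! h
    exact P.b_ne_zero i (Finsupp.ext h)

theorem IsLonely.hypergraph {P : BergmanPresentation X I} {x : X} {i : I} (hx : P.IsLonely x i) :
    P.hypergraph.IsLonely x i where
  source_self := by
    change P.a i x = 1
    rw [hx.left_eq, Finsupp.single_eq_same]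
  source_ne u hu := by
    change P.a i u = 0
    rw [hx.left_eq, Finsupp.single_eq_of_ne hu]
  not_range := hx.right_eq
  other := hx.other

theorem IsBasic.eliminate {P : BergmanPresentation X I} (hP : P.IsBasic) {x : X} {i : I}
    (hx : P.IsLonely x i) : (P.eliminate hP hx).IsBasic :=
  Set.eq_univ_of_forall fun _ j hj => absurd hj (hP.blue_eq j.1)

namespace IsBasic

variable {P : BergmanPresentation X I} (hP : P.IsBasic)

include hP in
theorem mem_base (x : X) : x ∈ P.base := by rw [hP]; trivial

/-- The only index of a generator of a basic presentation. -/
def idx (x : X) : P.Idx x := .base x (hP.mem_base x)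

include hP in
theorem subsingleton_idx (x : X) : Subsingleton (P.Idx x) := by
  refine ⟨fun p q => ?_⟩
  cases p with
  | step i hi => exact absurd hi (hP.blue_eq i)
  | base =>
    cases q with
    | step i hi => exact absurd hi (hP.blue_eq i)
    | base => rfl

theorem idx_eq {x : X} (p : P.Idx x) : p = hP.idx x :=
  (hP.subsingleton_idx x).elim _ _

/-- In a basic presentation, the rows of `ε_c` correspond to the summands of `c`. -/
def sumIdx (c : X →₀ ℕ) : MultIndex c ≃ P.SumIdx c where
  toFun y := ⟨y, hP.idx y.elt⟩
  invFun p := p.summand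
  left_inv _ := rfl
  right_inv p := by
    obtain ⟨y, p⟩ := p
    rw [hP.idx_eq p]

@[simp] theorem sumIdx_summand (c : X →₀ ℕ) (y : MultIndex c) :
    (hP.sumIdx c y).summand = y := rfl

variable (K : Type*) [Field K]

open Classical in
-- All blocks are `1 × 1`, so `ε_c` is diagonal; multiplying by it only scales rows or columns,
-- which makes the red relations entrywise.
theorem epsSum_sumIdx (c : X →₀ ℕ) (y z : MultIndex c) :
    epsSum K P c (hP.sumIdx c y) (hP.sumIdx c z) =
      if z = y then epsBase K P ⟨y.elt, hP.mem_base _⟩ else 0 := by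
  by_cases h : z = y
  · subst h
    rw [if_pos rfl]
    exact dif_pos (rfl : (hP.sumIdx c z).summand = (hP.sumIdx c z).summand)
  · rw [if_neg h]
    exact dif_neg (c := (hP.sumIdx c z).summand = (hP.sumIdx c y).summand) h

variable [Finite X]

theorem sum_sumIdx {A : Type*} [AddCommMonoid A] (c : X →₀ ℕ) (f : P.SumIdx c → A) :
    ∑ p, f p = ∑ y, f (hP.sumIdx c y) :=
  (Equiv.sum_comp (hP.sumIdx c) f).symm

open Classical in
theorem epsSum_mul_apply {n : Type*} (c : X →₀ ℕ)
    (M : Matrix (P.SumIdx c) n (FreeAlgebra K P.BGen)) (y : MultIndex c) (q : n) :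
    (epsSum K P c * M) (hP.sumIdx c y) q =
      epsBase K P ⟨y.elt, hP.mem_base _⟩ * M (hP.sumIdx c y) q := by
  rw [Matrix.mul_apply, hP.sum_sumIdx]
  simp [epsSum_sumIdx, ite_mul]

open Classical in
theorem mul_epsSum_apply {n : Type*} (c : X →₀ ℕ)
    (M : Matrix n (P.SumIdx c) (FreeAlgebra K P.BGen)) (y : MultIndex c) (q : n) :
    (M * epsSum K P c) q (hP.sumIdx c y) =
      M q (hP.sumIdx c y) * epsBase K P ⟨y.elt, hP.mem_base _⟩ := by
  rw [Matrix.mul_apply, hP.sum_sumIdx]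
  simp [epsSum_sumIdx, mul_ite]

/-- The element of `L(H)` attached to a generator of the Bergman algebra. -/
noncomputable def toLeavittGen : P.BGen → P.hypergraph.LeavittPathAlgebra K
  | .eps x _ _ => (P.hypergraph.leavittFamily K).vert x
  | .sig i _ p q => (P.hypergraph.leavittFamily K).edge i p.summand q.summand
  | .sig' i _ p q => (P.hypergraph.leavittFamily K).ghost i q.summand p.summand

include hP in
-- Blue relations do not occur, and each red matrix relation, read entry by entry, follows from the
-- Leavitt relations of the corresponding hyperedge.
theorem toLeavitt_rel {x y : FreeAlgebra K P.BGen} (hxy : BRel K P x y) :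
    FreeAlgebra.lift K (toLeavittGen K (P := P)) x =
      FreeAlgebra.lift K (toLeavittGen K (P := P)) y := by
  classical
  have := Fintype.ofFinite X
  have heps : ∀ x : P.base, FreeAlgebra.lift K (toLeavittGen K (P := P)) (epsBase K P x) =
      (P.hypergraph.leavittFamily K).vert x.1 := fun x => FreeAlgebra.lift_ι_apply _ _
  have hsig : ∀ i (hi : i ∉ P.blue) p q,
      FreeAlgebra.lift K (toLeavittGen K (P := P)) (sigma K P i hi p q) =
        (P.hypergraph.leavittFamily K).edge i p.summand q.summand :=
    fun i hi p q => FreeAlgebra.lift_ι_apply _ _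
  have hsig' : ∀ i (hi : i ∉ P.blue) p q,
      FreeAlgebra.lift K (toLeavittGen K (P := P)) (sigma' K P i hi p q) =
        (P.hypergraph.leavittFamily K).ghost i q.summand p.summand :=
    fun i hi p q => FreeAlgebra.lift_ι_apply _ _
  have hsum : ∀ (c : X →₀ ℕ) (y z : MultIndex c),
      FreeAlgebra.lift K (toLeavittGen K (P := P))
        (epsSum K P c (hP.sumIdx c y) (hP.sumIdx c z)) =
      if y = z then (P.hypergraph.leavittFamily K).vert y.elt else 0 := by
    intro c y z
    rw [hP.epsSum_sumIdx, apply_ite (FreeAlgebra.lift K (toLeavittGen K (P := P))), heps, map_zero]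
    simp only [eq_comm]
  induction hxy with
  | base_mul x y =>
    rw [map_mul, apply_ite (FreeAlgebra.lift K (toLeavittGen K (P := P))), heps, heps, map_zero,
      (P.hypergraph.leavittFamily K).vert_mul]
    simp only [Subtype.ext_iff]
  | base_sum =>
    rw [finsum_eq_sum_of_fintype, map_sum, map_one,
      ← OrientedHypergraph.sum_vert_leavittFamily]
    simp only [heps]
    exact Fintype.sum_equiv (Equiv.subtypeUnivEquiv hP.mem_base) _ _ fun _ => rfl
  | blue_mul i hi => exact absurd hi (hP.blue_eq i)
  | blue_sum i hi => exact absurd hi (hP.blue_eq i)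
  | red_sigma i hi p q =>
    obtain ⟨p, rfl⟩ := (hP.sumIdx _).surjective p
    obtain ⟨q, rfl⟩ := (hP.sumIdx _).surjective q
    rw [hP.mul_epsSum_apply, hP.epsSum_mul_apply, map_mul, map_mul, heps, heps, hsig]
    exact (congrArg (· * _) ((P.hypergraph.leavittFamily K).vert_edge i p q)).trans
      ((P.hypergraph.leavittFamily K).edge_vert i p q)
  | red_sigma' i hi p q =>
    obtain ⟨p, rfl⟩ := (hP.sumIdx _).surjective p
    obtain ⟨q, rfl⟩ := (hP.sumIdx _).surjective q
    rw [hP.mul_epsSum_apply, hP.epsSum_mul_apply, map_mul, map_mul, heps, heps, hsig']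
    exact (congrArg (· * _) ((P.hypergraph.leavittFamily K).vert_ghost i q p)).trans
      ((P.hypergraph.leavittFamily K).ghost_vert i q p)
  | red_left i hi p q =>
    obtain ⟨p, rfl⟩ := (hP.sumIdx _).surjective p
    obtain ⟨q, rfl⟩ := (hP.sumIdx _).surjective q
    rw [Matrix.mul_apply, map_sum, hP.sum_sumIdx, hsum]
    simp only [map_mul, hsig, hsig', sumIdx_summand]
    exact (P.hypergraph.leavittFamily K).edge_ghost i p q
  | red_right i hi p q =>
    obtain ⟨p, rfl⟩ := (hP.sumIdx _).surjective p
    obtain ⟨q, rfl⟩ := (hP.sumIdx _).surjective q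
    rw [Matrix.mul_apply, map_sum, hP.sum_sumIdx, hsum]
    simp only [map_mul, hsig, hsig', sumIdx_summand]
    exact (P.hypergraph.leavittFamily K).ghost_edge i p q

/-- The homomorphism from the Bergman algebra of a basic presentation to the Leavitt path algebra
of the corresponding hypergraph. -/
noncomputable def toLeavitt : P.BergmanAlgebra K →ₐ[K] P.hypergraph.LeavittPathAlgebra K :=
  RingQuot.liftAlgHom K ⟨FreeAlgebra.lift K (toLeavittGen K), fun _ _ h => hP.toLeavitt_rel K h⟩

theorem toLeavitt_mk (g : P.BGen) :
    hP.toLeavitt K (RingQuot.mkAlgHom K (BRel K P) (FreeAlgebra.ι K g)) = toLeavittGen K g := by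
  rw [toLeavitt, RingQuot.liftAlgHom_mkAlgHom_apply, FreeAlgebra.lift_ι_apply]

theorem mk_epsBase_mul_self (x : P.base) :
    RingQuot.mkAlgHom K (BRel K P) (epsBase K P x) *
      RingQuot.mkAlgHom K (BRel K P) (epsBase K P x) =
        RingQuot.mkAlgHom K (BRel K P) (epsBase K P x) := by
  have := RingQuot.mkAlgHom_rel K (BRel.base_mul (K := K) (P := P) x x)
  rwa [if_pos rfl, map_mul] at this

/-- The Bergman relation fixes `σ` from both sides at once; with the idempotency of `ε` it yields
the two one-sided relations of a Leavitt family. -/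
theorem mk_eps_mul_sigma_mul_eps (i : I) (p : MultIndex (P.a i)) (q : MultIndex (P.b i)) :
    RingQuot.mkAlgHom K (BRel K P) (epsBase K P ⟨p.elt, hP.mem_base _⟩) *
      RingQuot.mkAlgHom K (BRel K P)
        (sigma K P i (hP.blue_eq i) (hP.sumIdx (P.a i) p) (hP.sumIdx (P.b i) q)) *
      RingQuot.mkAlgHom K (BRel K P) (epsBase K P ⟨q.elt, hP.mem_base _⟩) =
    RingQuot.mkAlgHom K (BRel K P)
      (sigma K P i (hP.blue_eq i) (hP.sumIdx (P.a i) p) (hP.sumIdx (P.b i) q)) := by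
  have := RingQuot.mkAlgHom_rel K (BRel.red_sigma (K := K) (P := P) i (hP.blue_eq i)
    (hP.sumIdx (P.a i) p) (hP.sumIdx (P.b i) q))
  rwa [hP.mul_epsSum_apply, hP.epsSum_mul_apply, map_mul, map_mul] at this

theorem mk_eps_mul_sigma'_mul_eps (i : I) (p : MultIndex (P.a i)) (q : MultIndex (P.b i)) :
    RingQuot.mkAlgHom K (BRel K P) (epsBase K P ⟨q.elt, hP.mem_base _⟩) *
      RingQuot.mkAlgHom K (BRel K P)
        (sigma' K P i (hP.blue_eq i) (hP.sumIdx (P.b i) q) (hP.sumIdx (P.a i) p)) *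
      RingQuot.mkAlgHom K (BRel K P) (epsBase K P ⟨p.elt, hP.mem_base _⟩) =
    RingQuot.mkAlgHom K (BRel K P)
      (sigma' K P i (hP.blue_eq i) (hP.sumIdx (P.b i) q) (hP.sumIdx (P.a i) p)) := by
  have := RingQuot.mkAlgHom_rel K (BRel.red_sigma' (K := K) (P := P) i (hP.blue_eq i)
    (hP.sumIdx (P.b i) q) (hP.sumIdx (P.a i) p))
  rwa [hP.mul_epsSum_apply, hP.epsSum_mul_apply, map_mul, map_mul] at this

/-- The generators of the Bergman algebra of a basic presentation as a Leavitt family. -/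
noncomputable def family : P.hypergraph.LeavittFamily (P.BergmanAlgebra K) where
  vert x := RingQuot.mkAlgHom K (BRel K P) (epsBase K P ⟨x, hP.mem_base x⟩)
  edge i p q := RingQuot.mkAlgHom K (BRel K P)
    (sigma K P i (hP.blue_eq i) (hP.sumIdx (P.a i) p) (hP.sumIdx (P.b i) q))
  ghost i p q := RingQuot.mkAlgHom K (BRel K P)
    (sigma' K P i (hP.blue_eq i) (hP.sumIdx (P.b i) q) (hP.sumIdx (P.a i) p))
  vert_mul u v := by
    have := RingQuot.mkAlgHom_rel K
      (BRel.base_mul (K := K) (P := P) ⟨u, hP.mem_base u⟩ ⟨v, hP.mem_base v⟩)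
    rw [map_mul] at this
    rw [this]
    by_cases h : u = v
    · subst h
      rw [if_pos rfl, if_pos rfl]
    · rw [if_neg h, if_neg fun e => h (congrArg Subtype.val e), map_zero]
  vert_edge i p q := by
    rw [← hP.mk_eps_mul_sigma_mul_eps K i p q, ← mul_assoc, ← mul_assoc, mk_epsBase_mul_self]
  edge_vert i p q := by
    rw [← hP.mk_eps_mul_sigma_mul_eps K i p q, mul_assoc, mk_epsBase_mul_self]
  vert_ghost i p q := by
    rw [← hP.mk_eps_mul_sigma'_mul_eps K i p q, ← mul_assoc, ← mul_assoc, mk_epsBase_mul_self]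
  ghost_vert i p q := by
    rw [← hP.mk_eps_mul_sigma'_mul_eps K i p q, mul_assoc, mk_epsBase_mul_self]
  edge_ghost i p p' := by
    have := RingQuot.mkAlgHom_rel K (BRel.red_left (K := K) (P := P) i (hP.blue_eq i)
      (hP.sumIdx (P.a i) p) (hP.sumIdx (P.a i) p'))
    rw [hP.epsSum_sumIdx, apply_ite (RingQuot.mkAlgHom K (BRel K P)), Matrix.mul_apply, map_sum,
      hP.sum_sumIdx, map_zero] at this
    simp only [map_mul] at this
    refine this.trans ?_
    by_cases h : p = p'
    · rw [if_pos h, if_pos h.symm]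
    · rw [if_neg h, if_neg (Ne.symm h)]
  ghost_edge i q q' := by
    have := RingQuot.mkAlgHom_rel K (BRel.red_right (K := K) (P := P) i (hP.blue_eq i)
      (hP.sumIdx (P.b i) q) (hP.sumIdx (P.b i) q'))
    rw [hP.epsSum_sumIdx, apply_ite (RingQuot.mkAlgHom K (BRel K P)), Matrix.mul_apply, map_sum,
      hP.sum_sumIdx, map_zero] at this
    simp only [map_mul] at this
    refine this.trans ?_
    by_cases h : q = q'
    · rw [if_pos h, if_pos h.symm]
    · rw [if_neg h, if_neg (Ne.symm h)]

theorem unit_family : (hP.family K).unit = 1 := by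
  have := Fintype.ofFinite X
  classical
  have h := RingQuot.mkAlgHom_rel K (BRel.base_sum (K := K) (P := P))
  rw [finsum_eq_sum_of_fintype, map_sum, map_one] at h
  rw [OrientedHypergraph.LeavittFamily.unit, finsum_eq_sum_of_fintype, ← h]
  exact (Fintype.sum_equiv (Equiv.subtypeUnivEquiv hP.mem_base) _ _ fun _ => rfl).symm

/-- The Bergman algebra of a basic presentation is isomorphic to the Leavitt path algebra of the
corresponding hypergraph. -/
noncomputable def leavittEquiv : P.BergmanAlgebra K ≃ₐ[K] P.hypergraph.LeavittPathAlgebra K :=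
  AlgEquiv.ofAlgHom (hP.toLeavitt K) ((hP.family K).liftUnital K (hP.unit_family K))
    (by
      refine AlgHom.ext fun a => ?_
      induction a using OrientedHypergraph.leavitt_induction with
      | vert u =>
        rw [AlgHom.comp_apply, OrientedHypergraph.liftUnital_vert]
        exact hP.toLeavitt_mk K _
      | edge i p q =>
        rw [AlgHom.comp_apply, OrientedHypergraph.liftUnital_edge]
        exact hP.toLeavitt_mk K _
      | ghost i p q =>
        rw [AlgHom.comp_apply, OrientedHypergraph.liftUnital_ghost]
        exact hP.toLeavitt_mk K _
      | zero => rw [map_zero, map_zero]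
      | add a b ha hb => rw [map_add, ha, hb, map_add]
      | mul a b ha hb => rw [map_mul, ha, hb, map_mul]
      | smul k a ha => rw [map_smul, ha, map_smul])
    (by
      apply RingQuot.ringQuot_ext'
      apply FreeAlgebra.hom_ext
      funext g
      change (hP.family K).liftUnital K _
        (hP.toLeavitt K (RingQuot.mkAlgHom K (BRel K P) (FreeAlgebra.ι K g))) =
          RingQuot.mkAlgHom K (BRel K P) (FreeAlgebra.ι K g)
      rw [hP.toLeavitt_mk]
      cases g with
      | eps x p q =>
        rw [toLeavittGen, OrientedHypergraph.liftUnital_vert, hP.idx_eq p, hP.idx_eq q]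
        rfl
      | sig i hi p q =>
        obtain ⟨p, rfl⟩ := (hP.sumIdx _).surjective p
        obtain ⟨q, rfl⟩ := (hP.sumIdx _).surjective q
        exact OrientedHypergraph.liftUnital_edge ..
      | sig' i hi p q =>
        obtain ⟨p, rfl⟩ := (hP.sumIdx _).surjective p
        obtain ⟨q, rfl⟩ := (hP.sumIdx _).surjective q
        exact OrientedHypergraph.liftUnital_ghost ..)

end IsBasic

/-- Eliminating a lonely generator does not change the Bergman algebra up to Morita equivalence. -/
theorem isMoritaEquivalent_eliminate [Finite X] (K : Type*) [Field K]
    {P : BergmanPresentation X I} (hP : P.IsBasic) {x : X} {i : I} (hx : P.IsLonely x i) :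
    IsMoritaEquivalent K (BergmanAlgebra K (P.eliminate hP hx)) (BergmanAlgebra K P) :=
  -- The hypergraph of the reduced presentation is definitionally the reduced hypergraph, so the two
  -- isomorphisms with Leavitt path algebras can be joined by the full corner.
  ((IsMoritaEquivalent.of_algEquiv K ((hP.eliminate hx).leavittEquiv K)).trans K
    (hx.hypergraph.fullCornerHom K).isMoritaEquivalent).trans K
    (IsMoritaEquivalent.of_algEquiv K (hP.leavittEquiv K).symm)

end BergmanPresentation

/-! ### From presentations to Bergman graphs -/

namespace BergmanGraph

variable {V E : Type*} {H : BergmanGraph V E}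

theorem IsLonely.toOrientedHypergraph {v : V} {h : E} (hv : H.IsLonely v h) :
    H.toOrientedHypergraph.IsLonely v h :=
  ⟨hv.source_self, hv.source_ne, hv.not_range, hv.other⟩

theorem IsLonely.toPresentation [Finite V] {v : V} {h : E} (hv : H.IsLonely v h) :
    H.toPresentation.IsLonely v h where
  left_eq := by
    classical
    ext u
    change H.s h u = _
    by_cases hu : u = v
    · rw [hu, hv.source_self, Finsupp.single_eq_same]
    · rw [hv.source_ne u hu, Finsupp.single_eq_of_ne hu]
  right_eq := hv.not_range
  other := hv.other

theorem IsBasic.toPresentation [Finite V] (hH : H.IsBasic) : H.toPresentation.IsBasic := hH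

/-- This reduces the Morita equivalence for graphs to the one for presentations. -/
theorem toPresentation_eliminate [Finite V] (hH : H.IsBasic) {v : V} {h : E}
    (hv : H.IsLonely v h) :
    (H.eliminate hH hv).toPresentation =
      H.toPresentation.eliminate hH.toPresentation hv.toPresentation := by
  have ha : (H.eliminate hH hv).toPresentation.a =
      (H.toPresentation.eliminate hH.toPresentation hv.toPresentation).a :=
    funext fun g => Finsupp.ext fun u => rfl
  have hb : (H.eliminate hH hv).toPresentation.b =
      (H.toPresentation.eliminate hH.toPresentation hv.toPresentation).b :=
    funext fun g => Finsupp.ext fun u => rfl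
  have hblue : (H.eliminate hH hv).toPresentation.blue =
      (H.toPresentation.eliminate hH.toPresentation hv.toPresentation).blue := rfl
  -- Once both sides are variables, their data can be substituted along the three equations; the
  -- remaining fields are proofs.
  generalize (H.eliminate hH hv).toPresentation = P at *
  generalize H.toPresentation.eliminate hH.toPresentation hv.toPresentation = Q at *
  obtain ⟨⟨_, _⟩⟩ := P
  obtain ⟨⟨_, _⟩⟩ := Q
  dsimp only at ha hb hblue
  subst ha hb hblue
  rfl

end BergmanGraph

theorem mainTheorem5 (K : Type*) [Field K] :
    (∀ (V E : Type*) [Finite V] [Finite E] (H : BergmanGraph V E) (hH : H.IsBasic)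
      (v : V) (h : E) (hv : H.IsLonely v h),
      IsMoritaEquivalent K ((H.eliminate hH hv).BergmanAlgebra K) (H.BergmanAlgebra K) ∧
      ∃ e : H.toOrientedHypergraph.LeavittPathAlgebra K,
        e = H.toOrientedHypergraph.coVertL K v ∧
        IsIdempotentElem e ∧
        TwoSidedIdeal.span {e} = ⊤ ∧
        ∃ φ : (H.eliminate hH hv).toOrientedHypergraph.LeavittPathAlgebra K →ₙₐ[K]
            H.toOrientedHypergraph.LeavittPathAlgebra K,
          Function.Injective φ ∧ Set.range φ = {x | ∃ a, x = e * a * e}) ∧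
    (∀ (X I : Type*) [Finite X] [Finite I] (P : BergmanPresentation X I) (hP : P.IsBasic)
      (x : X) (i : I) (hx : P.IsLonely x i),
      IsMoritaEquivalent K (BergmanPresentation.BergmanAlgebra K (P.eliminate hP hx))
        (BergmanPresentation.BergmanAlgebra K P)) := by
  refine ⟨fun V E _ _ H hH v h hv => ⟨?_, _, rfl, ?_, ?_, ?_⟩, fun X I _ _ P hP x i hx => ?_⟩
  · change IsMoritaEquivalent K
      (BergmanPresentation.BergmanAlgebra K (H.eliminate hH hv).toPresentation) _
    rw [BergmanGraph.toPresentation_eliminate]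
    exact BergmanPresentation.isMoritaEquivalent_eliminate K hH.toPresentation hv.toPresentation
  · exact hv.toOrientedHypergraph.isIdempotentElem_coVertL K
  · exact hv.toOrientedHypergraph.span_coVertL K
  · exact ⟨hv.toOrientedHypergraph.cornerHom K, hv.toOrientedHypergraph.cornerHom_injective K,
      hv.toOrientedHypergraph.range_cornerHom K⟩
  · exact BergmanPresentation.isMoritaEquivalent_eliminate K hP hx
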